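/- Let $z$ be the affine coordinate on $\mathbb{P}^1_{\mathbb{C}}$, $w=z^{-1}$, and let $(\mathcal{E},\nabla)$ be a rank $3$ vector bundle on $\mathbb{P}^1$ with a meromorphic connection whose only pole is at $\infty$. Let $\mathbb{M}$ be the associated left $\mathbb{C}[z]\langle\partial_z\rangle$-module of sections of $\mathcal{E}$ over the affine line; in a global frame over the affine line $\nabla=\mathrm{d}+A(z)\,\mathrm{d}z$ with $A$ a $3\times 3$ matrix of polynomials, $\mathbb{M}=\mathbb{C}[z]^3$, and $\partial_z v=v'+Av$. Let $\mathcal{E}_\infty$ be the ring of formal series $\sum_{i\ge i_0}a_i(w)\hat w^i$, $i_0\in\mathbb{Z}$, $a_i\in\mathbb{C}[\![w]\!]$, with the product determined by $\hat w\cdot a(z)=\sum_{k\ge 0}(-1)^k a^{(k)}(z)\hat w^{k+1}$ (derivatives with respect to $z$), so that $\hat w=\partial_z^{-1}$. Let $\mathcal{E}_\infty[w^{-1}]=\bigcup_{n} w^{-n}\mathcal{E}_\infty$, let $\mathbb{C}[z]\langle\partial_z\rangle\to\mathcal{E}_\infty[w^{-1}]$ be the ring homomorphism $z\mapsto w^{-1}$,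 $\partial_z\mapsto\hat w^{-1}$, and let $$\mathbb{M}^\mu_\infty=\mathcal{E}_\infty[w^{-1}]\otimes_{\mathbb{C}[z]\langle\partial_z\rangle}\mathbb{M}$$ be the formal microlocalization of $\mathbb{M}$ at $\infty$. Its rank $\operatorname{rk}(\mathbb{M}^\mu_\infty)$ is its dimension over the field $\mathbb{C}(\!(\hat w)\!)\subset\mathcal{E}_\infty[w^{-1}]$. Suppose that in some formal local frame of $\mathcal{E}$ at $\infty$ $$\nabla=\mathrm{d}+\bigl[L_3w^{-3}+L_2w^{-2}+L_1w^{-1}+O(1)\bigr]\mathrm{d}w,$$ where $O(1)$ is a matrix over $\mathbb{C}[\![w]\!]$ and the constant matrices $L_3,L_2,L_1$ are in one of the following three cases (the $c_i\in\mathbb{C}$ are arbitrary): * (JKTIVb) $L_3=\operatorname{diag}(0,t_1,t_2)$ with $t_1,t_2\neq 0$, $t_1\neq t_2$; $L_2=\operatorname{diag}(0,b_1,b_2)$ with $b_1,b_2\in\mathbb{C}$; $L_1=\operatorname{diag}(c_0,c_1,c_2)$; * (JKTII) $L_3=\begin{pmatrix}0&1&0\\0&0&0\\0&0&t\end{pmatrix}$,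 $L_2=\begin{pmatrix}0&0&0\\b&0&0\\0&0&0\end{pmatrix}$, $L_1=\begin{pmatrix}0&0&0\\c_0&c_1&0\\0&0&c_2\end{pmatrix}$ with $t\neq 0$, $b\neq 0$; * (JKTI) $L_3=\begin{pmatrix}0&1&0\\0&0&1\\0&0&0\end{pmatrix}$, $L_2=\begin{pmatrix}0&0&0\\0&0&0\\b&0&0\end{pmatrix}$, $L_1=\begin{pmatrix}0&0&0\\0&0&0\\c_0&c_1&c_2\end{pmatrix}$ with $b\neq 0$. Then $\operatorname{rk}(\mathbb{M}^\mu_\infty)=2$. -/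

import Mathlib

open Polynomial LaurentSeries
open scoped TensorProduct

/-! ## The Weyl algebra `ℂ[z]⟨∂_z⟩` -/

/-- The defining relation `∂ z = z ∂ + 1`; generator `0` is `z`, generator `1` is `∂_z`. -/
inductive WeylRel : FreeAlgebra ℂ (Fin 2) → FreeAlgebra ℂ (Fin 2) → Prop
  | comm : WeylRel (FreeAlgebra.ι ℂ 1 * FreeAlgebra.ι ℂ 0)
      (FreeAlgebra.ι ℂ 0 * FreeAlgebra.ι ℂ 1 + 1)

/-- The Weyl algebra `ℂ[z]⟨∂_z⟩` of polynomial differential operators on the affine line. -/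
def WeylAlgebra : Type := RingQuot WeylRel

namespace WeylAlgebra

noncomputable instance : Ring WeylAlgebra := inferInstanceAs (Ring (RingQuot WeylRel))

noncomputable instance : Algebra ℂ WeylAlgebra :=
  inferInstanceAs (Algebra ℂ (RingQuot WeylRel))

/-- The operator `z`. -/
noncomputable def z : WeylAlgebra := RingQuot.mkAlgHom ℂ WeylRel (FreeAlgebra.ι ℂ 0)

/-- The operator `∂_z`. -/
noncomputable def d : WeylAlgebra := RingQuot.mkAlgHom ℂ WeylRel (FreeAlgebra.ι ℂ 1)

/-- The universal property: a pair `a, b` with `b a = a b + 1` in a `ℂ`-algebra `B` gives the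
algebra homomorphism `z ↦ a`, `∂_z ↦ b`. -/
noncomputable def lift {B : Type*} [Ring B] [Algebra ℂ B] (a b : B) (h : b * a = a * b + 1) :
    WeylAlgebra →ₐ[ℂ] B :=
  RingQuot.liftAlgHom ℂ ⟨FreeAlgebra.lift ℂ ![a, b], by
    rintro _ _ ⟨⟩
    simp [h]⟩

theorem lift_z {B : Type*} [Ring B] [Algebra ℂ B] (a b : B) (h : b * a = a * b + 1) :
    lift a b h z = a := by
  unfold lift z
  exact (RingQuot.liftAlgHom_mkAlgHom_apply ..).trans (by simp)

theorem lift_d {B : Type*} [Ring B] [Algebra ℂ B] (a b : B) (h : b * a = a * b + 1) :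
    lift a b h d = b := by
  unfold lift d
  exact (RingQuot.liftAlgHom_mkAlgHom_apply ..).trans (by simp)

end WeylAlgebra

/-! ## Formal microdifferential operators at infinity

An element of `E_∞[w⁻¹]`, `w = z⁻¹`, is a formal series `∑_{i ≥ i₀} a_i(w) ŵ^i` in which the
`a_i` are Laurent series in `w` with a pole of order at most `n`, for some `n` independent of
`i`.  It is stored as the family of its coefficients: the coefficient of `w^j ŵ^i` sits at the
exponent `(j, i)`.  The supports allowed are exactly the subsets of quadrants
`{(j, i) | j ≥ j₀, i ≥ i₀}` of `ℤ × ℤ`, that is, the partially well-ordered subsets of `ℤ × ℤ` for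
the product order (`MicroSymbol.exists_bound` and `MicroSymbol.isPWO_quadrant`). -/

/-- Symbols: coefficient families, with the *commutative* multiplication of series in `w, ŵ`. -/
abbrev MicroSymbol : Type := HahnSeries (ℤ × ℤ) ℂ

namespace MicroSymbol

/-- `f` has only terms `w^j ŵ^i` with `j, i ≥ m`. -/
def Bound (m : ℤ) (f : MicroSymbol) : Prop := ∀ p, f.coeff p ≠ 0 → m ≤ p.1 ∧ m ≤ p.2

theorem isPWO_quadrant (m : ℤ) : {p : ℤ × ℤ | m ≤ p.1 ∧ m ≤ p.2}.IsPWO := by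
  have h : (Set.Ici m : Set ℤ).IsPWO := (isWF_iff_isPWO_aux m)
  exact (h.prod h).mono (fun p hp => ⟨hp.1, hp.2⟩)
where
  isWF_iff_isPWO_aux (m : ℤ) : (Set.Ici m : Set ℤ).IsPWO :=
    (BddBelow.isWF (bddBelow_Ici (a := m))).isPWO

theorem exists_bound (f : MicroSymbol) : ∃ m, Bound m f := by
  have h : ∀ g : ℤ × ℤ → ℤ, Monotone g → ∃ m, ∀ p, f.coeff p ≠ 0 → m ≤ g p := by
    intro g hg
    have hw : (g '' f.support).IsWF := (f.isPWO_support.image_of_monotone hg).isWF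
    by_cases hne : (g '' f.support).Nonempty
    · refine ⟨hw.min hne, fun p hp => hw.min_le hne ⟨p, hp, rfl⟩⟩
    · exact ⟨0, fun p hp => (hne ⟨g p, p, hp, rfl⟩).elim⟩
  obtain ⟨a, ha⟩ := h Prod.fst monotone_fst
  obtain ⟨b, hb⟩ := h Prod.snd monotone_snd
  exact ⟨min a b, fun p hp => ⟨(min_le_left _ _).trans (ha p hp),
    (min_le_right _ _).trans (hb p hp)⟩⟩

theorem Bound.mono {m n : ℤ} {f : MicroSymbol} (h : Bound m f) (hn : n ≤ m) : Bound n f :=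
  fun p hp => ⟨hn.trans (h p hp).1, hn.trans (h p hp).2⟩

theorem Bound.coeff_eq_zero {m : ℤ} {f : MicroSymbol} (h : Bound m f) {p : ℤ × ℤ}
    (hp : p.1 < m) : f.coeff p = 0 := by
  by_contra hne
  have := (h p hne).1
  omega

theorem Bound.mul {m n : ℤ} {f g : MicroSymbol} (hf : Bound m f) (hg : Bound n g) :
    Bound (m + n) (f * g) := by
  intro p hp
  obtain ⟨a, ha, b, hb, rfl⟩ := HahnSeries.support_mul_subset hp
  have h1 := hf a ha
  have h2 := hg b hb
  simp only [Prod.fst_add, Prod.snd_add]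
  omega

/-- The Euler operator `w^j ŵ^i ↦ χ(j, i) w^j ŵ^i` of an additive weight `χ`. -/
noncomputable def eulerLinear (χ : ℤ × ℤ →+ ℂ) : MicroSymbol →ₗ[ℂ] MicroSymbol where
  toFun f := ⟨fun p => χ p * f.coeff p, f.isPWO_support.mono fun _ hp => right_ne_zero_of_mul hp⟩
  map_add' f g := by ext p; simp [mul_add]
  map_smul' c f := by ext p; simp [mul_left_comm]

theorem coeff_eulerLinear (χ : ℤ × ℤ →+ ℂ) (f : MicroSymbol) (p : ℤ × ℤ) :
    (eulerLinear χ f).coeff p = χ p * f.coeff p := rfl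

/-- The Euler operator as a derivation of the commutative algebra of symbols. -/
noncomputable def euler (χ : ℤ × ℤ →+ ℂ) : Derivation ℂ MicroSymbol MicroSymbol :=
  Derivation.mk' (eulerLinear χ) (by
    intro f g
    have hs : ∀ f : MicroSymbol, (eulerLinear χ f).support ⊆ f.support :=
      fun f p hp => right_ne_zero_of_mul hp
    ext p
    simp only [smul_eq_mul, HahnSeries.coeff_add]
    rw [coeff_eulerLinear, HahnSeries.coeff_mul, mul_comm g,
      HahnSeries.coeff_mul_right' g.isPWO_support (hs g),
      HahnSeries.coeff_mul_left' f.isPWO_support (hs f), ← Finset.sum_add_distrib,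
      Finset.mul_sum]
    refine Finset.sum_congr rfl fun ij hij => ?_
    have hij' : ij.1 + ij.2 = p := by simpa using (Finset.mem_antidiagonal.1 hij).2.2
    rw [← hij', map_add, coeff_eulerLinear, coeff_eulerLinear]
    ring)

theorem coeff_euler (χ : ℤ × ℤ →+ ℂ) (f : MicroSymbol) (p : ℤ × ℤ) :
    (euler χ f).coeff p = χ p * f.coeff p := rfl

/-- The weight `-j` of `w^j ŵ^i = z^(-j) ŵ^i`. -/
def weightZ : ℤ × ℤ →+ ℂ := -((Int.castAddHom ℂ).comp (AddMonoidHom.fst ℤ ℤ))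

/-- The weight `-i` of `w^j ŵ^i = w^j ẑ^(-i)`. -/
def weightZhat : ℤ × ℤ →+ ℂ := -((Int.castAddHom ℂ).comp (AddMonoidHom.snd ℤ ℤ))

/-- The derivation `∂/∂z`, i.e. `w^j ŵ^i ↦ -j w^(j+1) ŵ^i`. -/
noncomputable def dz : Derivation ℂ MicroSymbol MicroSymbol :=
  (HahnSeries.single ((1, 0) : ℤ × ℤ) (1 : ℂ) : MicroSymbol) • euler weightZ

/-- The derivation `∂/∂ẑ`, i.e. `w^j ŵ^i ↦ -i w^j ŵ^(i+1)`. -/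
noncomputable def dzhat : Derivation ℂ MicroSymbol MicroSymbol :=
  (HahnSeries.single ((0, 1) : ℤ × ℤ) (1 : ℂ) : MicroSymbol) • euler weightZhat

theorem coeff_dz (f : MicroSymbol) (p : ℤ × ℤ) :
    (dz f).coeff p = -((p.1 : ℂ) - 1) * f.coeff (p.1 - 1, p.2) := by
  have := HahnSeries.coeff_single_mul (r := (1 : ℂ)) (x := euler weightZ f) (a := p)
    (b := ((1, 0) : ℤ × ℤ))
  simpa [dz, coeff_euler, weightZ, Prod.sub_def] using this

theorem coeff_dzhat (f : MicroSymbol) (p : ℤ × ℤ) :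
    (dzhat f).coeff p = -((p.2 : ℂ) - 1) * f.coeff (p.1, p.2 - 1) := by
  have := HahnSeries.coeff_single_mul (r := (1 : ℂ)) (x := euler weightZhat f) (a := p)
    (b := ((0, 1) : ℤ × ℤ))
  simpa [dzhat, coeff_euler, weightZhat, Prod.sub_def] using this

theorem dz_dzhat (f : MicroSymbol) : dz (dzhat f) = dzhat (dz f) := by
  ext p
  simp only [coeff_dz, coeff_dzhat]
  ring

theorem coeff_dz_ne {m n : ℤ} {f : MicroSymbol} (h : ∀ p, f.coeff p ≠ 0 → m ≤ p.1 ∧ n ≤ p.2)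
    (p : ℤ × ℤ) (hp : (dz f).coeff p ≠ 0) : m + 1 ≤ p.1 ∧ n ≤ p.2 := by
  rw [coeff_dz] at hp
  have := h _ (right_ne_zero_of_mul hp)
  simp only at this
  omega

theorem coeff_dzhat_ne {m n : ℤ} {f : MicroSymbol}
    (h : ∀ p, f.coeff p ≠ 0 → m ≤ p.1 ∧ n ≤ p.2)
    (p : ℤ × ℤ) (hp : (dzhat f).coeff p ≠ 0) : m ≤ p.1 ∧ n + 1 ≤ p.2 := by
  rw [coeff_dzhat] at hp
  have := h _ (right_ne_zero_of_mul hp)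
  simp only at this
  omega

theorem coeff_dz_iterate_ne {m n : ℤ} {f : MicroSymbol}
    (h : ∀ p, f.coeff p ≠ 0 → m ≤ p.1 ∧ n ≤ p.2) (k : ℕ) :
    ∀ p, (dz^[k] f).coeff p ≠ 0 → m + k ≤ p.1 ∧ n ≤ p.2 := by
  induction k with
  | zero => simpa using h
  | succ k ih =>
    intro p hp
    rw [Function.iterate_succ_apply'] at hp
    have := coeff_dz_ne ih p hp
    push_cast
    omega

theorem coeff_dzhat_iterate_ne {m n : ℤ} {f : MicroSymbol}
    (h : ∀ p, f.coeff p ≠ 0 → m ≤ p.1 ∧ n ≤ p.2) (k : ℕ) :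
    ∀ p, (dzhat^[k] f).coeff p ≠ 0 → m ≤ p.1 ∧ n + k ≤ p.2 := by
  induction k with
  | zero => simpa using h
  | succ k ih =>
    intro p hp
    rw [Function.iterate_succ_apply'] at hp
    have := coeff_dzhat_ne ih p hp
    push_cast
    omega

section Leibniz

variable {A : Type*} [CommRing A] [Algebra ℂ A] (D E : Derivation ℂ A A)

/-- The bidifferential operator `(1/k!) D^k f · E^k g`. -/
noncomputable def bidiff (k : ℕ) (f g : A) : A := ((k.factorial : ℂ)⁻¹) • (D^[k] f * E^[k] g)

theorem bidiff_add_left (k : ℕ) (f f' g : A) :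
    bidiff D E k (f + f') g = bidiff D E k f g + bidiff D E k f' g := by
  simp [bidiff, iterate_map_add, add_mul]

theorem bidiff_add_right (k : ℕ) (f g g' : A) :
    bidiff D E k f (g + g') = bidiff D E k f g + bidiff D E k f g' := by
  simp [bidiff, iterate_map_add, mul_add]

theorem iterate_smul' (k : ℕ) (c : ℂ) (f : A) : D^[k] (c • f) = c • D^[k] f := by
  induction k with
  | zero => rfl
  | succ k ih => rw [Function.iterate_succ_apply', ih, Derivation.map_smul, Function.iterate_succ_apply']

theorem iterate_sum' {ι : Type*} (s : Finset ι) (k : ℕ) (f : ι → A) :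
    D^[k] (∑ i ∈ s, f i) = ∑ i ∈ s, D^[k] (f i) := by
  induction k with
  | zero => rfl
  | succ k ih => simp only [Function.iterate_succ_apply', ih, map_sum]

theorem bidiff_smul_left (k : ℕ) (c : ℂ) (f g : A) :
    bidiff D E k (c • f) g = c • bidiff D E k f g := by
  rw [bidiff, bidiff, iterate_smul', smul_mul_assoc, smul_comm]

theorem bidiff_smul_right (k : ℕ) (c : ℂ) (f g : A) :
    bidiff D E k f (c • g) = c • bidiff D E k f g := by
  rw [bidiff, bidiff, iterate_smul', mul_smul_comm, smul_comm]

theorem bidiff_sum_left {ι : Type*} (s : Finset ι) (k : ℕ) (f : ι → A) (g : A) :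
    bidiff D E k (∑ i ∈ s, f i) g = ∑ i ∈ s, bidiff D E k (f i) g := by
  simp only [bidiff, iterate_sum', Finset.sum_mul, Finset.smul_sum]

theorem bidiff_sum_right {ι : Type*} (s : Finset ι) (k : ℕ) (f : A) (g : ι → A) :
    bidiff D E k f (∑ i ∈ s, g i) = ∑ i ∈ s, bidiff D E k f (g i) := by
  simp only [bidiff, iterate_sum', Finset.mul_sum, Finset.smul_sum]

theorem iterate_leibniz (n : ℕ) (f g : A) :
    D^[n] (f * g) = ∑ ij ∈ Finset.HasAntidiagonal.antidiagonal n,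
      n.choose ij.1 • (D^[ij.1] f * D^[ij.2] g) := by
  induction n with
  | zero => simp
  | succ n ih =>
    rw [Finset.sum_antidiagonal_choose_succ_nsmul
      (fun i j => D^[i] f * D^[j] g) n, Function.iterate_succ_apply', ih, map_sum,
      ← Finset.sum_add_distrib]
    refine Finset.sum_congr rfl fun ij hij => ?_
    rw [map_nsmul, Derivation.leibniz, Function.iterate_succ_apply', Function.iterate_succ_apply',
      Nat.choose_symm_of_eq_add (Finset.HasAntidiagonal.mem_antidiagonal.1 hij).symm, smul_eq_mul, smul_eq_mul,
      nsmul_add, mul_comm (D^[ij.2] g)]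

theorem iterate_leibniz_inv (n : ℕ) (f g : A) :
    ((n.factorial : ℂ)⁻¹) • D^[n] (f * g) = ∑ ij ∈ Finset.HasAntidiagonal.antidiagonal n,
      (((ij.1.factorial : ℂ)⁻¹) * ((ij.2.factorial : ℂ)⁻¹)) • (D^[ij.1] f * D^[ij.2] g) := by
  rw [iterate_leibniz, Finset.smul_sum]
  refine Finset.sum_congr rfl fun ij hij => ?_
  rw [← Nat.cast_smul_eq_nsmul ℂ, smul_smul]
  congr 1
  have hn := Finset.HasAntidiagonal.mem_antidiagonal.1 hij
  subst hn
  have h := Nat.add_choose_mul_factorial_mul_factorial ij.1 ij.2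
  rw [← Nat.choose_symm_add] at h
  have h' : ((ij.1 + ij.2).choose ij.1 : ℂ) * ij.1.factorial * ij.2.factorial
      = (ij.1 + ij.2).factorial := by exact_mod_cast h
  have h1 : (ij.1.factorial : ℂ) ≠ 0 := by exact_mod_cast Nat.factorial_ne_zero _
  have h2 : (ij.2.factorial : ℂ) ≠ 0 := by exact_mod_cast Nat.factorial_ne_zero _
  have h3 : ((ij.1 + ij.2).factorial : ℂ) ≠ 0 := by exact_mod_cast Nat.factorial_ne_zero _
  field_simp
  linear_combination h'

theorem bidiff_assoc (hDE : Function.Commute D E) (n : ℕ) (f g h : A) :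
    ∑ kl ∈ Finset.HasAntidiagonal.antidiagonal n, bidiff D E kl.1 (bidiff D E kl.2 f g) h =
      ∑ kl ∈ Finset.HasAntidiagonal.antidiagonal n, bidiff D E kl.1 f (bidiff D E kl.2 g h) := by
  have hL : ∀ kl : ℕ × ℕ, bidiff D E kl.1 (bidiff D E kl.2 f g) h =
      ∑ ij ∈ Finset.HasAntidiagonal.antidiagonal kl.1,
        ((ij.1.factorial : ℂ)⁻¹ * (ij.2.factorial : ℂ)⁻¹ * (kl.2.factorial : ℂ)⁻¹) •
        (D^[ij.1 + kl.2] f * D^[ij.2] (E^[kl.2] g) * E^[ij.1 + ij.2] h) := by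
    intro kl
    rw [bidiff.eq_def D E kl.2, bidiff_smul_left, bidiff, ← smul_mul_assoc, iterate_leibniz_inv,
      Finset.sum_mul, Finset.smul_sum]
    refine Finset.sum_congr rfl fun ij hij => ?_
    rw [smul_mul_assoc, smul_smul, Finset.HasAntidiagonal.mem_antidiagonal.1 hij, Function.iterate_add_apply]
    congr 1
    ring
  have hR : ∀ kl : ℕ × ℕ, bidiff D E kl.1 f (bidiff D E kl.2 g h) =
      ∑ ij ∈ Finset.HasAntidiagonal.antidiagonal kl.1,
        ((ij.1.factorial : ℂ)⁻¹ * (ij.2.factorial : ℂ)⁻¹ * (kl.2.factorial : ℂ)⁻¹) •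
        (D^[ij.1 + ij.2] f * D^[kl.2] (E^[ij.1] g) * E^[ij.2 + kl.2] h) := by
    intro kl
    rw [bidiff.eq_def D E kl.2, bidiff_smul_right, bidiff, ← mul_smul_comm, iterate_leibniz_inv,
      Finset.mul_sum, Finset.smul_sum]
    refine Finset.sum_congr rfl fun ij hij => ?_
    rw [mul_smul_comm, smul_smul, Finset.HasAntidiagonal.mem_antidiagonal.1 hij, Function.iterate_add_apply,
      (hDE.iterate_iterate kl.2 ij.1).eq g]
    congr 1
    · ring
    · ring
  simp only [hL, hR]
  rw [Finset.sum_sigma', Finset.sum_sigma']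
  refine Finset.sum_bij' (fun x _ => ⟨(x.1.2 + x.2.1, x.2.2), (x.1.2, x.2.1)⟩)
    (fun x _ => ⟨(x.2.2 + x.1.2, x.2.1), (x.2.2, x.1.2)⟩) ?_ ?_ ?_ ?_ ?_
  · rintro ⟨⟨k, l⟩, ⟨i, j⟩⟩ hx
    rw [Finset.mem_sigma, Finset.HasAntidiagonal.mem_antidiagonal,
      Finset.HasAntidiagonal.mem_antidiagonal] at hx ⊢
    dsimp only at hx ⊢
    exact ⟨by omega, rfl⟩
  · rintro ⟨⟨k, l⟩, ⟨i, j⟩⟩ hx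
    rw [Finset.mem_sigma, Finset.HasAntidiagonal.mem_antidiagonal,
      Finset.HasAntidiagonal.mem_antidiagonal] at hx ⊢
    dsimp only at hx ⊢
    exact ⟨by omega, rfl⟩
  · rintro ⟨⟨k, l⟩, ⟨i, j⟩⟩ hx
    simp only [Finset.mem_sigma, Finset.HasAntidiagonal.mem_antidiagonal] at hx ⊢
    obtain ⟨-, rfl⟩ := hx
    rfl
  · rintro ⟨⟨k, l⟩, ⟨i, j⟩⟩ hx
    simp only [Finset.mem_sigma, Finset.HasAntidiagonal.mem_antidiagonal] at hx ⊢
    obtain ⟨-, rfl⟩ := hx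
    rfl
  · rintro ⟨⟨k, l⟩, ⟨i, j⟩⟩ hx
    simp only [add_comm l i]
    congr 1
    ring

end Leibniz

theorem Bound.add {m : ℤ} {f g : MicroSymbol} (hf : Bound m f) (hg : Bound m g) :
    Bound m (f + g) := by
  intro p hp
  rw [HahnSeries.coeff_add] at hp
  by_cases h : f.coeff p = 0
  · exact hg p (by simpa [h] using hp)
  · exact hf p h

/-- The `k`-th term `(1/k!) (∂/∂ẑ)^k f · (∂/∂z)^k g` of the product of two operators. -/
noncomputable def term (k : ℕ) (f g : MicroSymbol) : MicroSymbol := bidiff dzhat dz k f g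

theorem Bound.term {m n : ℤ} {f g : MicroSymbol} (hf : Bound m f) (hg : Bound n g) (k : ℕ) :
    Bound (m + n + k) (term k f g) := by
  intro p hp
  obtain ⟨a, ha, b, hb, rfl⟩ := HahnSeries.support_mul_subset
    (HahnSeries.support_smul_subset _ _ hp)
  have h1 := coeff_dzhat_iterate_ne hf k a ha
  have h2 := coeff_dz_iterate_ne hg k b hb
  simp only [Prod.fst_add, Prod.snd_add]
  omega

theorem Bound.sum {ι : Type*} {m : ℤ} (s : Finset ι) {f : ι → MicroSymbol}
    (h : ∀ i ∈ s, Bound m (f i)) : Bound m (∑ i ∈ s, f i) := by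
  intro p hp
  rw [HahnSeries.coeff_sum] at hp
  obtain ⟨i, hi, hne⟩ := Finset.exists_ne_zero_of_sum_ne_zero hp
  exact h i hi p hne

/-- The coefficients of the product of two operators with symbols `f` and `g` (for every exponent
only finitely many `k` contribute). -/
noncomputable def starCoeff (f g : MicroSymbol) (p : ℤ × ℤ) : ℂ := ∑ᶠ k : ℕ, (term k f g).coeff p

theorem starCoeff_eq {m n : ℤ} {f g : MicroSymbol} (hf : Bound m f) (hg : Bound n g) {N : ℕ}
    {p : ℤ × ℤ} (hp : p.1 < m + n + N ∨ p.2 < m + n + N) :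
    starCoeff f g p = ∑ k ∈ Finset.range N, (term k f g).coeff p := by
  refine finsum_eq_sum_of_support_subset _ fun k hk => ?_
  have := hf.term hg k p hk
  simp only [Finset.coe_range, Set.mem_Iio]
  omega

theorem starCoeff_ne {m n : ℤ} {f g : MicroSymbol} (hf : Bound m f) (hg : Bound n g)
    {p : ℤ × ℤ} (hp : starCoeff f g p ≠ 0) : m + n ≤ p.1 ∧ m + n ≤ p.2 := by
  obtain ⟨k, hk⟩ : ∃ k : ℕ, (MicroSymbol.term k f g).coeff p ≠ 0 := by
    by_contra! h
    exact hp (by simp [starCoeff, h])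
  have := hf.term hg k p hk
  omega

/-- The product of operators, on symbols in normal form (powers of `ŵ` to the right):
`f ⋆ g = ∑_k (1/k!) (∂/∂ẑ)^k f · (∂/∂z)^k g`.  In particular
`ŵ ⋆ a(z) = ∑_k (-1)^k a^{(k)}(z) ŵ^{k+1}`. -/
noncomputable def star (f g : MicroSymbol) : MicroSymbol where
  coeff := starCoeff f g
  isPWO_support' := by
    obtain ⟨m, hm⟩ := exists_bound f
    obtain ⟨n, hn⟩ := exists_bound g
    exact (isPWO_quadrant (m + n)).mono fun p hp => starCoeff_ne hm hn hp

theorem coeff_star {m n : ℤ} {f g : MicroSymbol} (hf : Bound m f) (hg : Bound n g) {N : ℕ}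
    {p : ℤ × ℤ} (hp : p.1 < m + n + N ∨ p.2 < m + n + N) :
    (star f g).coeff p = ∑ k ∈ Finset.range N, (term k f g).coeff p :=
  starCoeff_eq hf hg hp

theorem Bound.star {m n : ℤ} {f g : MicroSymbol} (hf : Bound m f) (hg : Bound n g) :
    Bound (m + n) (star f g) := fun _ hp => starCoeff_ne hf hg hp

theorem exists_lt (a b : ℤ) : ∃ N : ℕ, a < b + N := ⟨(a - b).toNat + 1, by push_cast; omega⟩

theorem exists_common_bound (f g h : MicroSymbol) :
    ∃ m : ℤ, Bound m f ∧ Bound m g ∧ Bound m h := by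
  obtain ⟨a, ha⟩ := exists_bound f
  obtain ⟨b, hb⟩ := exists_bound g
  obtain ⟨c, hc⟩ := exists_bound h
  exact ⟨min a (min b c), ha.mono (by omega), hb.mono (by omega), hc.mono (by omega)⟩

theorem star_add_left (f f' g : MicroSymbol) : star (f + f') g = star f g + star f' g := by
  obtain ⟨m, hf, hf', hg⟩ := exists_common_bound f f' g
  ext p
  obtain ⟨N, hN⟩ := exists_lt p.1 (m + m)
  rw [HahnSeries.coeff_add, coeff_star (hf.add hf') hg (.inl hN), coeff_star hf hg (.inl hN),
    coeff_star hf' hg (.inl hN), ← Finset.sum_add_distrib]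
  simp only [term, bidiff_add_left, HahnSeries.coeff_add]

theorem star_add_right (f g g' : MicroSymbol) : star f (g + g') = star f g + star f g' := by
  obtain ⟨m, hf, hg, hg'⟩ := exists_common_bound f g g'
  ext p
  obtain ⟨N, hN⟩ := exists_lt p.1 (m + m)
  rw [HahnSeries.coeff_add, coeff_star hf (hg.add hg') (.inl hN), coeff_star hf hg (.inl hN),
    coeff_star hf hg' (.inl hN), ← Finset.sum_add_distrib]
  simp only [term, bidiff_add_right, HahnSeries.coeff_add]

theorem Bound.smul {m : ℤ} {f : MicroSymbol} (hf : Bound m f) (c : ℂ) : Bound m (c • f) :=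
  fun p hp => hf p (HahnSeries.support_smul_subset _ _ hp)

theorem star_smul_left (c : ℂ) (f g : MicroSymbol) : star (c • f) g = c • star f g := by
  obtain ⟨m, hf, hg, -⟩ := exists_common_bound f g g
  ext p
  obtain ⟨N, hN⟩ := exists_lt p.1 (m + m)
  rw [HahnSeries.coeff_smul, coeff_star (hf.smul c) hg (.inl hN), coeff_star hf hg (.inl hN), Finset.smul_sum]
  simp only [term, bidiff_smul_left, HahnSeries.coeff_smul]

theorem star_smul_right (c : ℂ) (f g : MicroSymbol) : star f (c • g) = c • star f g := by
  obtain ⟨m, hf, hg, -⟩ := exists_common_bound f g g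
  ext p
  obtain ⟨N, hN⟩ := exists_lt p.1 (m + m)
  rw [HahnSeries.coeff_smul, coeff_star hf (hg.smul c) (.inl hN), coeff_star hf hg (.inl hN), Finset.smul_sum]
  simp only [term, bidiff_smul_right, HahnSeries.coeff_smul]

theorem star_eq_mul_of_dzhat {f : MicroSymbol} (hf : dzhat f = 0) (g : MicroSymbol) :
    star f g = f * g := by
  ext p
  refine (finsum_eq_single _ 0 fun k hk => ?_).trans (by simp [term, bidiff])
  obtain ⟨k, rfl⟩ := Nat.exists_eq_succ_of_ne_zero hk
  simp [term, bidiff, Function.iterate_succ_apply, hf, iterate_map_zero]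

theorem star_eq_mul_of_dz (f : MicroSymbol) {g : MicroSymbol} (hg : dz g = 0) :
    star f g = f * g := by
  ext p
  refine (finsum_eq_single _ 0 fun k hk => ?_).trans (by simp [term, bidiff])
  obtain ⟨k, rfl⟩ := Nat.exists_eq_succ_of_ne_zero hk
  simp [term, bidiff, Function.iterate_succ_apply, hg, iterate_map_zero]

theorem star_zero_left (f : MicroSymbol) : star 0 f = 0 :=
  (star_eq_mul_of_dzhat (map_zero _) f).trans (zero_mul f)

theorem star_zero_right (f : MicroSymbol) : star f 0 = 0 :=
  (star_eq_mul_of_dz f (map_zero _)).trans (mul_zero f)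

theorem sum_range_range_eq {M : Type*} [AddCommMonoid M] (N : ℕ) (F : ℕ → ℕ → M)
    (h : ∀ k l, N ≤ k + l → F k l = 0) :
    ∑ k ∈ Finset.range N, ∑ l ∈ Finset.range N, F k l =
      ∑ n ∈ Finset.range N, ∑ kl ∈ Finset.HasAntidiagonal.antidiagonal n, F kl.1 kl.2 := by
  rw [Finset.sum_sigma', Finset.sum_sigma']
  refine (Finset.sum_of_injOn (fun x => ⟨x.2.1, x.2.2⟩) ?_ ?_ ?_ ?_).symm
  · rintro ⟨n, k, l⟩ hx ⟨n', k', l'⟩ hx' he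
    simp at hx hx' he
    obtain ⟨rfl, rfl⟩ := he
    obtain ⟨-, rfl⟩ := hx
    obtain ⟨-, rfl⟩ := hx'
    rfl
  · rintro ⟨n, k, l⟩ hx
    simp at hx ⊢
    omega
  · rintro ⟨k, l⟩ hx hx'
    refine h k l ?_
    by_contra hlt
    exact hx' ⟨⟨k + l, (k, l)⟩, by simpa using hlt, rfl⟩
  · intro x hx
    rfl

theorem Bound.sub {m : ℤ} {f g : MicroSymbol} (hf : Bound m f) (hg : Bound m g) :
    Bound m (f - g) := by
  rw [sub_eq_add_neg, ← neg_one_smul ℂ g]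
  exact hf.add (hg.smul _)

theorem bound_star_sub {m n : ℤ} {f g : MicroSymbol} (hf : Bound m f) (hg : Bound n g) (N : ℕ) :
    Bound (m + n + N) (star f g - ∑ k ∈ Finset.range N, MicroSymbol.term k f g) := by
  intro p hp
  by_contra hlt
  refine hp ?_
  rw [HahnSeries.coeff_sub, coeff_star hf hg (N := N) (by omega), HahnSeries.coeff_sum, sub_self]

theorem coeff_star_star_left {m : ℤ} {f g h : MicroSymbol} (hf : Bound m f) (hg : Bound m g)
    (hh : Bound m h) {N : ℕ} {p : ℤ × ℤ} (hp : p.1 < m + m + m + N) :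
    (star (star f g) h).coeff p = ∑ n ∈ Finset.range N,
      (∑ kl ∈ Finset.HasAntidiagonal.antidiagonal n, term kl.1 (term kl.2 f g) h).coeff p := by
  have key : ∀ k : ℕ, (term k (star f g) h).coeff p =
      ∑ l ∈ Finset.range N, (term k (term l f g) h).coeff p := by
    intro k
    rw [← sub_add_cancel (star f g) (∑ l ∈ Finset.range N, term l f g), term, bidiff_add_left,
      HahnSeries.coeff_add, bidiff_sum_left, HahnSeries.coeff_sum]
    refine (add_eq_right.2 ?_)
    by_contra hne
    have := ((bound_star_sub hf hg N).term hh k p hne).1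
    omega
  rw [coeff_star (hf.star hg) hh (.inl hp)]
  simp only [key, HahnSeries.coeff_sum]
  refine sum_range_range_eq N (fun k l => (term k (term l f g) h).coeff p) fun k l hkl => ?_
  by_contra hne
  have := ((hf.term hg l).term hh k p hne).1
  omega

theorem coeff_star_star_right {m : ℤ} {f g h : MicroSymbol} (hf : Bound m f) (hg : Bound m g)
    (hh : Bound m h) {N : ℕ} {p : ℤ × ℤ} (hp : p.1 < m + m + m + N) :
    (star f (star g h)).coeff p = ∑ n ∈ Finset.range N,
      (∑ kl ∈ Finset.HasAntidiagonal.antidiagonal n, term kl.1 f (term kl.2 g h)).coeff p := by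
  have key : ∀ k : ℕ, (term k f (star g h)).coeff p =
      ∑ l ∈ Finset.range N, (term k f (term l g h)).coeff p := by
    intro k
    rw [← sub_add_cancel (star g h) (∑ l ∈ Finset.range N, term l g h), term, bidiff_add_right,
      HahnSeries.coeff_add, bidiff_sum_right, HahnSeries.coeff_sum]
    refine (add_eq_right.2 ?_)
    by_contra hne
    have := (hf.term (bound_star_sub hg hh N) k p hne).1
    omega
  rw [coeff_star hf (hg.star hh) (N := N) (.inl (by omega))]
  simp only [key, HahnSeries.coeff_sum]
  refine sum_range_range_eq N (fun k l => (term k f (term l g h)).coeff p) fun k l hkl => ?_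
  by_contra hne
  have := (hf.term (hg.term hh l) k p hne).1
  omega

theorem star_assoc (f g h : MicroSymbol) : star (star f g) h = star f (star g h) := by
  obtain ⟨m, hf, hg, hh⟩ := exists_common_bound f g h
  ext p
  obtain ⟨N, hN⟩ := exists_lt p.1 (m + m + m)
  rw [coeff_star_star_left hf hg hh hN, coeff_star_star_right hf hg hh hN]
  refine Finset.sum_congr rfl fun n _ => ?_
  congr 1
  exact bidiff_assoc dzhat dz (fun f => (dz_dzhat f).symm) n f g h

end MicroSymbol

/-- The ring `E_∞[w⁻¹]` of formal microdifferential operators at infinity: series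
`∑_{i ≥ i₀} a_i(w) ŵ^i`, with `a_i ∈ w⁻ⁿ ℂ⟦w⟧` for some `n` independent of `i`, multiplied by
`ŵ a(z) = ∑_k (-1)^k a^{(k)}(z) ŵ^{k+1}`. -/
def MicroInfty : Type := MicroSymbol

namespace MicroInfty

noncomputable instance : AddCommGroup MicroInfty := inferInstanceAs (AddCommGroup MicroSymbol)

noncomputable instance : Module ℂ MicroInfty := inferInstanceAs (Module ℂ MicroSymbol)

/-- The operator with a given symbol. -/
noncomputable def ofSymbol : MicroSymbol ≃ₗ[ℂ] MicroInfty := LinearEquiv.refl ℂ MicroSymbol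

noncomputable instance : Mul MicroInfty :=
  ⟨fun f g => ofSymbol (MicroSymbol.star (ofSymbol.symm f) (ofSymbol.symm g))⟩

noncomputable instance : One MicroInfty := ⟨ofSymbol 1⟩

theorem ofSymbol_mul (f g : MicroSymbol) :
    ofSymbol f * ofSymbol g = ofSymbol (MicroSymbol.star f g) := rfl

theorem ofSymbol_one : ofSymbol 1 = 1 := rfl

noncomputable instance : Ring MicroInfty :=
  { (inferInstance : AddCommGroup MicroInfty) with
    mul := (· * ·)
    one := 1
    mul_assoc := fun f g h => MicroSymbol.star_assoc f g h
    left_distrib := fun f g h => MicroSymbol.star_add_right f g h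
    right_distrib := fun f g h => MicroSymbol.star_add_left f g h
    zero_mul := fun f => MicroSymbol.star_zero_left f
    mul_zero := fun f => MicroSymbol.star_zero_right f
    one_mul := fun f =>
      (MicroSymbol.star_eq_mul_of_dzhat (Derivation.map_one_eq_zero _) f).trans (one_mul _)
    mul_one := fun f =>
      (MicroSymbol.star_eq_mul_of_dz f (Derivation.map_one_eq_zero _)).trans (mul_one _) }

noncomputable instance : Algebra ℂ MicroInfty :=
  Algebra.ofModule (fun c f g => MicroSymbol.star_smul_left c f g)
    (fun c f g => MicroSymbol.star_smul_right c f g)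

/-- The monomial `w^j ŵ^i`. -/
noncomputable def monomial (j i : ℤ) : MicroInfty :=
  ofSymbol (HahnSeries.single ((j, i) : ℤ × ℤ) (1 : ℂ))

theorem dz_single (j i : ℤ) (c : ℂ) :
    MicroSymbol.dz (HahnSeries.single ((j, i) : ℤ × ℤ) c) =
      HahnSeries.single ((j + 1, i) : ℤ × ℤ) (-(j : ℂ) * c) := by
  ext ⟨a, b⟩
  simp only [MicroSymbol.coeff_dz, HahnSeries.coeff_single, Prod.mk.injEq]
  by_cases h : a = j + 1 ∧ b = i
  · obtain ⟨rfl, rfl⟩ := h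
    simp
  · rw [if_neg (by omega), if_neg h, mul_zero]

theorem dzhat_single (j i : ℤ) (c : ℂ) :
    MicroSymbol.dzhat (HahnSeries.single ((j, i) : ℤ × ℤ) c) =
      HahnSeries.single ((j, i + 1) : ℤ × ℤ) (-(i : ℂ) * c) := by
  ext ⟨a, b⟩
  simp only [MicroSymbol.coeff_dzhat, HahnSeries.coeff_single, Prod.mk.injEq]
  by_cases h : a = j ∧ b = i + 1
  · obtain ⟨rfl, rfl⟩ := h
    simp
  · rw [if_neg (by omega), if_neg h, mul_zero]

/-- `ẑ z = z ẑ + 1` for `z = w⁻¹`, `ẑ = ŵ⁻¹`. -/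
theorem monomial_comm : monomial 0 (-1) * monomial (-1) 0 =
    monomial (-1) 0 * monomial 0 (-1) + 1 := by
  have h1 : monomial (-1) 0 * monomial 0 (-1) = monomial (-1) (-1) := by
    rw [monomial, monomial, ofSymbol_mul, MicroSymbol.star_eq_mul_of_dzhat (by simp [dzhat_single])]
    simp [monomial]
  have h2 : monomial 0 (-1) * monomial (-1) 0 = monomial (-1) (-1) + 1 := by
    rw [monomial, monomial, ofSymbol_mul, monomial, ← ofSymbol_one, ← map_add]
    congr 1
    ext p
    have h3 : ∀ k : ℕ, 2 ≤ k → MicroSymbol.dzhat^[k]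
        (HahnSeries.single ((0, -1) : ℤ × ℤ) (1 : ℂ)) = 0 := by
      intro k hk
      obtain ⟨k, rfl⟩ := Nat.exists_eq_add_of_le' hk
      rw [Function.iterate_add_apply]
      simp [dzhat_single, iterate_map_zero]
    refine (finsum_eq_sum_of_support_subset (s := Finset.range 2) _ fun k hk => ?_).trans ?_
    · simp only [Finset.coe_range, Set.mem_Iio]
      by_contra hlt
      refine hk ?_
      simp [MicroSymbol.term, MicroSymbol.bidiff, h3 k (by omega)]
    · simp [Finset.sum_range_succ, MicroSymbol.term, MicroSymbol.bidiff, dzhat_single, dz_single,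
        HahnSeries.coeff_one, HahnSeries.coeff_single]
      congr
  rw [h1, h2]

/-- The ring homomorphism `ℂ[z]⟨∂_z⟩ → E_∞[w⁻¹]`, `z ↦ w⁻¹`, `∂_z ↦ ẑ = ŵ⁻¹`. -/
noncomputable def ofWeyl : WeylAlgebra →ₐ[ℂ] MicroInfty :=
  WeylAlgebra.lift (monomial (-1) 0) (monomial 0 (-1)) monomial_comm

/-- The inclusion of the field `ℂ((ŵ))` into `E_∞[w⁻¹]` as the series with constant `a_i`. -/
noncomputable def ofLaurent : ℂ⸨X⸩ →+* MicroInfty where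
  toFun f := ofSymbol (HahnSeries.embDomainRingHom (AddMonoidHom.inr ℤ ℤ)
    (fun a b h => (Prod.ext_iff.1 h).2) (fun a b => by simp) f)
  map_one' := by rw [map_one, ofSymbol_one]
  map_zero' := by rw [map_zero, map_zero]
  map_add' f g := by rw [map_add, map_add]
  map_mul' f g := by
    rw [ofSymbol_mul, MicroSymbol.star_eq_mul_of_dz, map_mul]
    ext ⟨a, b⟩
    rw [MicroSymbol.coeff_dz]
    by_cases ha : a = 1
    · simp [ha]
    · rw [HahnSeries.coeff_zero, mul_eq_zero]
      right
      refine HahnSeries.embDomain_of_notMem_range ?_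
      rintro ⟨c, hc⟩
      have : (0 : ℤ) = a - 1 := (Prod.ext_iff.1 hc).1
      omega

end MicroInfty

/-! ## Microlocalization at infinity -/

/-- The relations `s d ⊗ m = s ⊗ d m`, `d` in the Weyl algebra. -/
noncomputable def microRelations (M : Type*) [AddCommGroup M] [Module WeylAlgebra M] :
    Submodule MicroInfty (MicroInfty ⊗[ℤ] M) :=
  Submodule.span MicroInfty
    {x | ∃ (s : MicroInfty) (d : WeylAlgebra) (m : M),
      x = (s * MicroInfty.ofWeyl d) ⊗ₜ[ℤ] m - s ⊗ₜ[ℤ] (d • m)}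

/-- The formal microlocalization `M^μ_∞ = E_∞[w⁻¹] ⊗_{ℂ[z]⟨∂_z⟩} M` of a left module over the
Weyl algebra at infinity. -/
def MicrolocalizationInfty (M : Type*) [AddCommGroup M] [Module WeylAlgebra M] : Type _ :=
  (MicroInfty ⊗[ℤ] M) ⧸ microRelations M

namespace MicrolocalizationInfty

variable (M : Type*) [AddCommGroup M] [Module WeylAlgebra M]

noncomputable instance : AddCommGroup (MicrolocalizationInfty M) :=
  inferInstanceAs (AddCommGroup ((MicroInfty ⊗[ℤ] M) ⧸ microRelations M))

noncomputable instance : Module MicroInfty (MicrolocalizationInfty M) :=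
  inferInstanceAs (Module MicroInfty ((MicroInfty ⊗[ℤ] M) ⧸ microRelations M))

/-- The underlying `ℂ((ŵ))`-vector space. -/
noncomputable instance : Module ℂ⸨X⸩ (MicrolocalizationInfty M) :=
  Module.compHom (MicrolocalizationInfty M) MicroInfty.ofLaurent

/-- The rank of `M^μ_∞`: its dimension over `ℂ((ŵ))`. -/
noncomputable def rk : Cardinal := Module.rank ℂ⸨X⸩ (MicrolocalizationInfty M)

end MicrolocalizationInfty

/-! ## Connections on the affine line and their local form at infinity -/

/-- The module of sections over the affine line of a rank-`n` bundle with connection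
`∇ = d + A(z) dz`, in a global frame: column vectors of polynomials. -/
def ConnectionModule {n : ℕ} (_A : Matrix (Fin n) (Fin n) ℂ[X]) : Type := Fin n → ℂ[X]

namespace ConnectionModule

variable {n : ℕ} (A : Matrix (Fin n) (Fin n) ℂ[X])

noncomputable instance : AddCommGroup (ConnectionModule A) :=
  inferInstanceAs (AddCommGroup (Fin n → ℂ[X]))

/-- Multiplication by `z`. -/
noncomputable def mulZ : Module.End ℂ (Fin n → ℂ[X]) where
  toFun v i := X * v i
  map_add' v v' := by ext1 i; simp [mul_add]
  map_smul' c v := by ext1 i; simp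

/-- `∇_{∂_z} v = v' + A v`. -/
noncomputable def nabla : Module.End ℂ (Fin n → ℂ[X]) where
  toFun v i := derivative (v i) + (A.mulVec v) i
  map_add' v v' := by ext1 i; simp [Matrix.mulVec_add]; ring
  map_smul' c v := by ext1 i; simp [Matrix.mulVec_smul]

theorem nabla_mulZ : nabla A * mulZ = mulZ * nabla A + 1 := by
  refine LinearMap.ext fun v => funext fun i => ?_
  have h : A.mulVec (fun j => X * v j) = (X : ℂ[X]) • A.mulVec v := by
    rw [← Matrix.mulVec_smul]
    rfl
  simp only [Module.End.mul_apply, LinearMap.add_apply, Module.End.one_apply, nabla, mulZ,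
    LinearMap.coe_mk, AddHom.coe_mk, Pi.add_apply, h, Pi.smul_apply, smul_eq_mul,
    derivative_mul, derivative_X]
  ring

/-- The left module structure over the Weyl algebra: `∂_z` acts as `∇_{∂_z}`. -/
noncomputable instance : Module WeylAlgebra (ConnectionModule A) :=
  Module.compHom (Fin n → ℂ[X]) (WeylAlgebra.lift mulZ (nabla A) (nabla_mulZ A)).toRingHom

theorem z_smul (v : ConnectionModule A) (i : Fin n) : (WeylAlgebra.z • v) i = X * v i := by
  change (WeylAlgebra.lift mulZ (nabla A) (nabla_mulZ A) WeylAlgebra.z) v i = _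
  rw [WeylAlgebra.lift_z]
  rfl

theorem d_smul (v : ConnectionModule A) (i : Fin n) :
    (WeylAlgebra.d • v) i = derivative (v i) + (A.mulVec v) i := by
  change (WeylAlgebra.lift mulZ (nabla A) (nabla_mulZ A) WeylAlgebra.d) v i = _
  rw [WeylAlgebra.lift_d]
  rfl

end ConnectionModule

/-- The matrix of `A(z) dz` with respect to `dw`, `w = z⁻¹`: since `dz = -w⁻² dw`, it is
`-w⁻² A(w⁻¹)`, with entries in `ℂ((w))`. -/
noncomputable def connectionMatrixInfty {n : ℕ} (A : Matrix (Fin n) (Fin n) ℂ[X]) :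
    Matrix (Fin n) (Fin n) ℂ⸨X⸩ :=
  A.map fun p => -(HahnSeries.single (-2 : ℤ) (1 : ℂ)) *
    p.eval₂ HahnSeries.C (HahnSeries.single (-1 : ℤ) (1 : ℂ) : ℂ⸨X⸩)

/-- In a suitable formal frame at infinity (the columns of `G`), the connection `d + A(z) dz` is
`d + (L₃ w⁻³ + L₂ w⁻² + L₁ w⁻¹ + O(1)) dw`.  The lattice spanned by the frame extends the bundle to
infinity. -/
def HasLocalFormInfty {n : ℕ} (A : Matrix (Fin n) (Fin n) ℂ[X])
    (L₃ L₂ L₁ : Matrix (Fin n) (Fin n) ℂ) : Prop :=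
  ∃ (G : Matrix.GeneralLinearGroup (Fin n) ℂ⸨X⸩) (H : Matrix (Fin n) (Fin n) (PowerSeries ℂ)),
    G.val.map (LaurentSeries.derivative ℂ) + connectionMatrixInfty A * G.val =
      G.val * (L₃.map (HahnSeries.single (-3 : ℤ)) + L₂.map (HahnSeries.single (-2 : ℤ)) +
        L₁.map (HahnSeries.single (-1 : ℤ)) + H.map (HahnSeries.ofPowerSeries ℤ ℂ))

/-! In the formal frame at infinity, with connection matrix `B` along `∂_z`, the microlocalization
is the cokernel of `x ↦ x (∂ - Bᵀ)` on row vectors over `E_∞[w⁻¹]`. Heuristically, a formal summand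
of rank `r` and slope `σ > 1` contributes `(σ - 1) r`, and slopes at most `1` contribute nothing.
The three cases have slopes `0, 2, 2`; then `3/2` in rank two and `2`; then `5/3` in rank three, so
each total is `2`. The proof does not decompose the connection: it computes the cokernel by a
Weierstrass-type division.

Order the monomials `w^j ŵ^i e_k` by a weight `7 i + ω_k(j)`, where `ω_k` is piecewise linear with
slope `6` on positive values and `18` on negative ones. In the relation `w^j (∂ e_k - ∑ B_qk e_q)`
the term with `∂` costs weight `7`. In a component with a pole, the leading term of `B` costs at
most `6` when `j` is large and at least `8` when `j` is small. So `∂` leads on one side of a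
threshold and `B` on the other; in a regular component `∂` always leads. Every monomial `w^j e_q`
then leads exactly one relation, except for one monomial `w^0 e_q` in each of two components.

Division by leading terms is exact up to an operator that raises weights
(`LeadingChoice.raisesSupport_defect`). Its geometric series converges
(`RaisesSupport.exists_sub_eq`) and it has no nonzero fixed vector (`RaisesSupport.eq_zero`), so
remainders exist and are unique. Remainders are series in `ŵ` alone in the two exceptional
components, which gives a basis over `ℂ((ŵ))` (`rk_eq_card_root`). The lemmas `leadingChoice_of_…`
supply the weights in the three cases. -/

namespace MicroSymbol

/-! ### Weights and the convergence of geometric series -/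

section Weight

variable {ι : Type*}

/-- The weight `D i + ω_k(j)` of the monomial `w^j ŵ^i` in the `k`-th component. -/
def weight (D : ℤ) (ω : ι → ℤ → ℤ) (p : ι × ℤ × ℤ) : ℤ := D * p.2.2 + ω p.1 p.2.1

/-- The monomials whose exponents and weight are at least `-m`. -/
def InRegion (D : ℤ) (ω : ι → ℤ → ℤ) (m : ℤ) (p : ι × ℤ × ℤ) : Prop :=
  -m ≤ p.2.1 ∧ -m ≤ p.2.2 ∧ -m ≤ weight D ω p

/-- `p'` has larger weight than `p` and lies in all the large regions that contain `p`. -/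
def Raises (D : ℤ) (ω : ι → ℤ → ℤ) (p p' : ι × ℤ × ℤ) : Prop :=
  weight D ω p < weight D ω p' ∧ ∀ m : ℤ, 10 ≤ m → InRegion D ω m p → InRegion D ω m p'

/-- Every monomial of `T y` is raised from some monomial of `y`. -/
def RaisesSupport (D : ℤ) (ω : ι → ℤ → ℤ) (T : (ι → MicroSymbol) →+ (ι → MicroSymbol)) : Prop :=
  ∀ y k' q', (T y k').coeff q' ≠ 0 →
    ∃ k q, (y k).coeff q ≠ 0 ∧ Raises D ω (k, q) (k', q')

variable {D : ℤ} {ω : ι → ℤ → ℤ}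

theorem InRegion.mono {m n : ℤ} {p : ι × ℤ × ℤ} (h : InRegion D ω m p) (hmn : m ≤ n) :
    InRegion D ω n p :=
  ⟨by have := h.1; omega, by have := h.2.1; omega, by have := h.2.2; omega⟩

theorem exists_inRegion [Finite ι] (hD : 0 ≤ D) (hω : ∀ k, Monotone (ω k))
    (y : ι → MicroSymbol) :
    ∃ m : ℤ, 10 ≤ m ∧ ∀ k q, (y k).coeff q ≠ 0 → InRegion D ω m (k, q) := by
  have h : ∀ k, ∃ m : ℤ, 10 ≤ m ∧ ∀ q, (y k).coeff q ≠ 0 → InRegion D ω m (k, q) := by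
    intro k
    obtain ⟨b, hb⟩ := exists_bound (y k)
    refine ⟨max 10 (max (-b) (-(D * b + ω k b))), by omega, fun q hq => ?_⟩
    obtain ⟨h1, h2⟩ := hb q hq
    have h3 : D * b ≤ D * q.2 := mul_le_mul_of_nonneg_left h2 hD
    have h4 := hω k h1
    refine ⟨?_, ?_, ?_⟩ <;> simp only [weight] <;> omega
  choose m hm hq using h
  obtain ⟨M, hM⟩ := (Set.finite_range m).bddAbove
  refine ⟨max 10 M, by omega, fun k q h => (hq k q h).mono ?_⟩
  have := hM ⟨k, rfl⟩
  omega

variable {T : (ι → MicroSymbol) →+ (ι → MicroSymbol)}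

/-- The growth of the weight makes the iterates tend to zero coefficientwise. It does not bound both
exponents from below, so the region is carried along to keep all iterates in one quadrant, where
sums are again symbols. -/
theorem RaisesSupport.iterate (hT : RaisesSupport D ω T) {y : ι → MicroSymbol} {m : ℤ}
    (hm : 10 ≤ m) (hy : ∀ k q, (y k).coeff q ≠ 0 → InRegion D ω m (k, q)) (n : ℕ) :
    ∀ k q, (T^[n] y k).coeff q ≠ 0 → InRegion D ω m (k, q) ∧ -m + n ≤ weight D ω (k, q) := by
  induction n with
  | zero => intro k q h; exact ⟨hy k q h, by simpa using (hy k q h).2.2⟩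
  | succ n ih =>
    intro k' q' h
    rw [Function.iterate_succ_apply'] at h
    obtain ⟨k, q, hq, hlt, hreg⟩ := hT _ k' q' h
    obtain ⟨h1, h2⟩ := ih k q hq
    exact ⟨hreg m hm h1, by push_cast; omega⟩

/-- A fixed vector equals all its iterates, whose weights exceed any bound. -/
theorem RaisesSupport.eq_zero [Finite ι] (hT : RaisesSupport D ω T) (hD : 0 ≤ D)
    (hω : ∀ k, Monotone (ω k)) {y : ι → MicroSymbol} (h : T y = y) : y = 0 := by
  obtain ⟨m, hm, hy⟩ := exists_inRegion hD hω y
  ext k q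
  by_contra hne
  obtain ⟨N, hN⟩ := exists_lt (weight D ω (k, q)) (-m)
  have := (hT.iterate hm hy N k q (by rwa [Function.iterate_fixed h])).2
  omega

/-- The sum of the series `∑ Tⁿ y`. -/
theorem RaisesSupport.exists_geometric (hT : RaisesSupport D ω T) {y : ι → MicroSymbol} {m : ℤ}
    (hm : 10 ≤ m) (hy : ∀ k q, (y k).coeff q ≠ 0 → InRegion D ω m (k, q)) :
    ∃ s : ι → MicroSymbol, ∀ (N : ℕ) (k : ι) (q : ℤ × ℤ),
      ((s - ∑ n ∈ Finset.range N, T^[n] y) k).coeff q ≠ 0 → -m + N ≤ weight D ω (k, q) := by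
  have hit := hT.iterate hm hy
  -- The `n`-th iterate has weight at least `-m + n`, so only `n ≤ weight + m` contribute to a given
  -- coefficient; the `+ 1` makes the range include the last one.
  let c : ι → ℤ × ℤ → ℂ := fun k q =>
    ∑ n ∈ Finset.range (weight D ω (k, q) + m + 1).toNat, (T^[n] y k).coeff q
  have hc : ∀ k q, c k q ≠ 0 → -m ≤ q.1 ∧ -m ≤ q.2 := by
    intro k q h
    obtain ⟨n, -, hn⟩ := Finset.exists_ne_zero_of_sum_ne_zero h
    exact ⟨(hit n k q hn).1.1, (hit n k q hn).1.2.1⟩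
  refine ⟨fun k => ⟨c k, (isPWO_quadrant (-m)).mono fun q hq => hc k q hq⟩, fun N k q h => ?_⟩
  by_contra hlt
  refine h ?_
  rw [Pi.sub_apply, HahnSeries.coeff_sub, Finset.sum_apply, HahnSeries.coeff_sum, sub_eq_zero]
  refine Finset.sum_subset (Finset.range_mono (by omega)) fun n _ hn => ?_
  by_contra hne
  have := (hit n k q hne).2
  simp only [Finset.mem_range] at hn
  omega

/-- The solution is `∑ Tⁿ y`. As `T` is only additive, with no continuity assumed, the equation is
checked one coefficient at a time, with the tail of the series controlled by its weight. -/
theorem RaisesSupport.exists_sub_eq [Finite ι] (hT : RaisesSupport D ω T) (hD : 0 ≤ D)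
    (hω : ∀ k, Monotone (ω k)) (y : ι → MicroSymbol) : ∃ s, s - T s = y := by
  obtain ⟨m, hm, hy⟩ := exists_inRegion hD hω y
  obtain ⟨s, hs⟩ := hT.exists_geometric hm hy
  refine ⟨s, ?_⟩
  ext k q
  by_contra hne
  obtain ⟨N, hN⟩ := exists_lt (weight D ω (k, q)) (-m)
  set t := s - ∑ n ∈ Finset.range N, T^[n] y with ht
  -- Telescoping the partial sum leaves three terms, all of weight at least `-m + N`, hence
  -- invisible at the chosen monomial.
  have hsum : s - T s - y = t - T t - T^[N] y := by
    have h1 : ∑ n ∈ Finset.range N, (T^[n + 1] y - T^[n] y) = T^[N] y - y :=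
      Finset.sum_range_sub (fun n => T^[n] y) N
    simp only [Function.iterate_succ_apply', Finset.sum_sub_distrib] at h1
    rw [sub_eq_iff_eq_add] at h1
    rw [ht, map_sub, map_sum, h1]
    abel
  have h0 : ((t - T t - T^[N] y) k).coeff q ≠ 0 := by
    rw [← hsum]
    simpa [sub_eq_zero] using hne
  simp only [Pi.sub_apply, HahnSeries.coeff_sub] at h0
  by_cases ha : (t k).coeff q = 0
  · by_cases hb : (T t k).coeff q = 0
    · have := (hT.iterate hm hy N k q (by simpa [ha, hb] using h0)).2
      omega
    · obtain ⟨k₁, q₁, hq₁, hlt, -⟩ := hT t k q hb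
      have := hs N k₁ q₁ hq₁
      omega
  · have := hs N k q ha
    omega

end Weight

/-! ### Supports of products -/

theorem coeff_dz_iterate_exists {f : MicroSymbol} (k : ℕ) {p : ℤ × ℤ}
    (hp : (dz^[k] f).coeff p ≠ 0) : f.coeff (p.1 - k, p.2) ≠ 0 := by
  induction k generalizing p with
  | zero => simpa using hp
  | succ k ih =>
    rw [Function.iterate_succ_apply', coeff_dz] at hp
    have := ih (right_ne_zero_of_mul hp)
    push_cast
    rwa [add_comm (k : ℤ), ← sub_sub]

theorem coeff_dzhat_iterate_exists {f : MicroSymbol} (k : ℕ) {p : ℤ × ℤ}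
    (hp : (dzhat^[k] f).coeff p ≠ 0) : f.coeff (p.1, p.2 - k) ≠ 0 := by
  induction k generalizing p with
  | zero => simpa using hp
  | succ k ih =>
    rw [Function.iterate_succ_apply', coeff_dzhat] at hp
    have := ih (right_ne_zero_of_mul hp)
    push_cast
    rwa [add_comm (k : ℤ), ← sub_sub]

theorem coeff_term_exists {f g : MicroSymbol} {k : ℕ} {p : ℤ × ℤ} (hp : (term k f g).coeff p ≠ 0) :
    ∃ q r : ℤ × ℤ, f.coeff q ≠ 0 ∧ g.coeff r ≠ 0 ∧ p = (q.1 + r.1 + k, q.2 + r.2 + k) := by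
  obtain ⟨a, ha, b, hb, rfl⟩ := HahnSeries.support_mul_subset
    (HahnSeries.support_smul_subset _ _ hp)
  refine ⟨_, _, coeff_dzhat_iterate_exists k ha, coeff_dz_iterate_exists k hb, ?_⟩
  ext <;> simp <;> ring

/-- Each pair of derivatives in the product raises both exponents by one, so a noncommutative
correction moves a monomial diagonally upwards. The case of no derivatives is the commutative
product, which is why `coeff_star_sub_mul_exists` has `1 ≤ k`. -/
theorem coeff_star_exists {f g : MicroSymbol} {p : ℤ × ℤ} (hp : (star f g).coeff p ≠ 0) :
    ∃ (q r : ℤ × ℤ) (k : ℕ), f.coeff q ≠ 0 ∧ g.coeff r ≠ 0 ∧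
      p = (q.1 + r.1 + k, q.2 + r.2 + k) := by
  obtain ⟨m, hf, hg, -⟩ := exists_common_bound f g g
  obtain ⟨N, hN⟩ := exists_lt p.1 (m + m)
  rw [coeff_star hf hg (.inl hN)] at hp
  obtain ⟨k, -, hk⟩ := Finset.exists_ne_zero_of_sum_ne_zero hp
  obtain ⟨q, r, h⟩ := coeff_term_exists hk
  exact ⟨q, r, k, h⟩

theorem coeff_star_sub_mul_exists {f g : MicroSymbol} {p : ℤ × ℤ}
    (hp : (star f g - f * g).coeff p ≠ 0) :
    ∃ (q r : ℤ × ℤ) (k : ℕ), 1 ≤ k ∧ f.coeff q ≠ 0 ∧ g.coeff r ≠ 0 ∧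
      p = (q.1 + r.1 + k, q.2 + r.2 + k) := by
  obtain ⟨m, hf, hg, -⟩ := exists_common_bound f g g
  obtain ⟨N, hN⟩ := exists_lt p.1 (m + m)
  have h0 : MicroSymbol.term 0 f g = f * g := by simp [MicroSymbol.term, bidiff]
  rw [HahnSeries.coeff_sub, coeff_star hf hg (N := N + 1) (.inl (by push_cast; omega)),
    Finset.sum_range_succ', h0, add_sub_cancel_right] at hp
  obtain ⟨k, -, hk⟩ := Finset.exists_ne_zero_of_sum_ne_zero hp
  obtain ⟨q, r, h⟩ := coeff_term_exists hk
  exact ⟨q, r, k + 1, by omega, h⟩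

end MicroSymbol

namespace MicroSymbol

/-! ### The division theorem -/

/-- The inclusion of the Laurent series in `w`. -/
noncomputable def ofW : ℂ⸨X⸩ →+* MicroSymbol :=
  HahnSeries.embDomainRingHom (AddMonoidHom.inl ℤ ℤ)
    (fun _ _ h => (Prod.ext_iff.1 h).1) (fun a b => by simp)

theorem coeff_ofW (f : ℂ⸨X⸩) (j i : ℤ) :
    (ofW f).coeff (j, i) = if i = 0 then f.coeff j else 0 := by
  split_ifs with h
  · subst h
    exact HahnSeries.embDomain_coeff (f := ⟨⟨AddMonoidHom.inl ℤ ℤ, _⟩, _⟩) (a := j)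
  · refine HahnSeries.embDomain_of_notMem_range ?_
    rintro ⟨c, hc⟩
    exact h (Prod.ext_iff.1 hc).2.symm

theorem coeff_ofW_ne {f : ℂ⸨X⸩} {r : ℤ × ℤ} (h : (ofW f).coeff r ≠ 0) :
    r.2 = 0 ∧ f.coeff r.1 ≠ 0 := by
  obtain ⟨j, i⟩ := r
  rw [coeff_ofW] at h
  simpa using h

open Classical in
/-- The terms `w^j ŵ^i` of a symbol with `P j`. -/
noncomputable def cut (P : ℤ → Prop) : MicroSymbol →+ MicroSymbol where
  toFun f := ⟨fun q => if P q.1 then f.coeff q else 0,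
    f.isPWO_support.mono fun q hq => by
      simp only [Function.mem_support, ne_eq, ite_eq_right_iff, Classical.not_imp] at hq
      exact hq.2⟩
  map_zero' := by ext q; simp
  map_add' f g := by ext q; by_cases h : P q.1 <;> simp [h]

open Classical in
theorem coeff_cut (P : ℤ → Prop) (f : MicroSymbol) (q : ℤ × ℤ) :
    (cut P f).coeff q = if P q.1 then f.coeff q else 0 := rfl

theorem coeff_cut_ne {P : ℤ → Prop} {f : MicroSymbol} {q : ℤ × ℤ} (h : (cut P f).coeff q ≠ 0) :
    P q.1 ∧ f.coeff q ≠ 0 := by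
  classical
  rw [coeff_cut] at h
  simpa using h

section Division

variable {ι : Type*} {B : Matrix ι ι ℂ⸨X⸩} {D : ℤ} {ω : ι → ℤ → ℤ} {up : ι → ℤ → Prop}
  {p : ι → ι} {a : ι → ℤ} {root : ι → Prop}

/-- The part of the quotient led by `w^j ŵ⁻¹ e_k`. -/
noncomputable def upPart (up : ι → ℤ → Prop) (y : ι → MicroSymbol) (k : ι) : MicroSymbol :=
  cut (up k) (y k) * HahnSeries.single ((0, 1) : ℤ × ℤ) (1 : ℂ)

/-- The part of the quotient led by the terms of `B`. -/
noncomputable def lowPart (B : Matrix ι ι ℂ⸨X⸩) (up : ι → ℤ → Prop) (p : ι → ι) (a : ι → ℤ)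
    (y : ι → MicroSymbol) (k : ι) : MicroSymbol :=
  cut (fun j => ¬ up k (j - a k)) (y (p k)) *
    HahnSeries.single ((-a k, 0) : ℤ × ℤ) (-((B (p k) k).coeff (a k))⁻¹)

/-- The leading remainder. -/
noncomputable def rootPart (root : ι → Prop) (y : ι → MicroSymbol) (q : ι) : MicroSymbol :=
  cut (fun j => j = 0 ∧ root q) (y q)

open Classical in
theorem coeff_upPart (y : ι → MicroSymbol) (k : ι) (j i : ℤ) :
    (upPart up y k).coeff (j, i) = if up k j then (y k).coeff (j, i - 1) else 0 := by
  rw [upPart, HahnSeries.coeff_mul_single, coeff_cut]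
  simp

open Classical in
theorem coeff_lowPart (y : ι → MicroSymbol) (k : ι) (j i : ℤ) :
    (lowPart B up p a y k).coeff (j, i) = if ¬ up k j then
      -((B (p k) k).coeff (a k))⁻¹ * (y (p k)).coeff (j + a k, i) else 0 := by
  rw [lowPart, HahnSeries.coeff_mul_single, coeff_cut]
  simp [mul_comm]

open Classical in
theorem coeff_rootPart (y : ι → MicroSymbol) (q : ι) (j i : ℤ) :
    (rootPart root y q).coeff (j, i) = if j = 0 ∧ root q then (y q).coeff (j, i) else 0 := by
  rw [rootPart, coeff_cut]
  congr

open Classical in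
/-- The leading term of the entry `B_qk`. -/
noncomputable def leadTerm (B : Matrix ι ι ℂ⸨X⸩) (p : ι → ι) (a : ι → ℤ) (q k : ι) : MicroSymbol :=
  if q = p k then HahnSeries.single ((a k, 0) : ℤ × ℤ) ((B (p k) k).coeff (a k)) else 0

variable [Fintype ι]

/-- The row vector `x * (∂ - Bᵀ)`, for a matrix `B` of Laurent series in `w`. -/
noncomputable def relComb (B : Matrix ι ι ℂ⸨X⸩) :
    (ι → MicroSymbol) →+ (ι → MicroSymbol) where
  toFun x q := x q * HahnSeries.single ((0, -1) : ℤ × ℤ) (1 : ℂ) - ∑ k, star (x k) (ofW (B q k))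
  map_zero' := by ext1 q; simp [star_zero_left]
  map_add' x y := by
    ext1 q
    simp only [Pi.add_apply, add_mul, star_add_left, Finset.sum_add_distrib]
    abel

theorem relComb_apply (B : Matrix ι ι ℂ⸨X⸩) (x : ι → MicroSymbol) (q : ι) :
    relComb B x q = x q * HahnSeries.single ((0, -1) : ℤ × ℤ) (1 : ℂ) -
      ∑ k, star (x k) (ofW (B q k)) := rfl

/-- A choice, in every relation `w^j (∂ e_k - ∑_q B_qk e_q)`, of a leading monomial:
`w^j ŵ⁻¹ e_k` if `up k j`, and the term of exponent `j + a k` in `e_{p k}` otherwise.  The other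
monomials have larger weight, and every monomial `w^j e_q` leads exactly one relation, except
those with `j = 0` and `root q`. -/
structure LeadingChoice (B : Matrix ι ι ℂ⸨X⸩) (D : ℤ) (ω : ι → ℤ → ℤ) (up : ι → ℤ → Prop)
    (p : ι → ι) (a : ι → ℤ) (root : ι → Prop) : Prop where
  nonneg : 0 ≤ D
  mono : ∀ k, Monotone (ω k)
  bij : Function.Bijective p
  cover : ∀ k j,
    (up (p k) j ∧ up k (j - a k) ∧ ¬ (j = 0 ∧ root (p k))) ∨
    (¬ up (p k) j ∧ ¬ up k (j - a k) ∧ ¬ (j = 0 ∧ root (p k))) ∨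
    (¬ up (p k) j ∧ up k (j - a k) ∧ (j = 0 ∧ root (p k)))
  lead_ne : ∀ k j, ¬ up k j → (B (p k) k).coeff (a k) ≠ 0
  raises_up : ∀ k q j i c (l : ℕ), up k j → (B q k).coeff c ≠ 0 →
    Raises D ω (k, j, i) (q, j + c + l, i + 1 + l)
  raises_low : ∀ k j i, ¬ up k j → Raises D ω (p k, j + a k, i) (k, j, i - 1)
  raises_err : ∀ k q j i c (l : ℕ), ¬ up k j → (B q k).coeff c ≠ 0 →
    (1 ≤ l ∨ q ≠ p k ∨ c ≠ a k) → Raises D ω (p k, j + a k, i) (q, j + c + l, i + l)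

/-! ### Division by leading terms and its weight-raising defect -/

namespace LeadingChoice

/-- The failure of the leading division to be exact. -/
noncomputable def defect (B : Matrix ι ι ℂ⸨X⸩) (up : ι → ℤ → Prop) (p : ι → ι) (a : ι → ℤ)
    (root : ι → Prop) : (ι → MicroSymbol) →+ (ι → MicroSymbol) :=
  AddMonoidHom.mk' (fun y => y - (rootPart root y +
      relComb B (upPart up y + lowPart B up p a y))) (by
    intro y y'
    have h1 : rootPart root (y + y') = rootPart root y + rootPart root y' := by
      ext1 q; simp [rootPart]
    have h2 : upPart up (y + y') = upPart up y + upPart up y' := by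
      ext1 q; simp [upPart, add_mul]
    have h3 : lowPart B up p a (y + y') = lowPart B up p a y + lowPart B up p a y' := by
      ext1 q; simp [lowPart, add_mul]
    simp only [h1, h2, h3, map_add]
    abel)

theorem defect_apply (y : ι → MicroSymbol) : defect B up p a root y =
    y - (rootPart root y + relComb B (upPart up y + lowPart B up p a y)) := rfl

/-- With only leading terms kept and commutative multiplication, division is exact: `cover` assigns
each monomial to one relation led by `∂`, to one led by `B`, or to the remainder. The three summands
recover the three kinds of monomials. -/
theorem leading_division (h : LeadingChoice B D ω up p a root) (y : ι → MicroSymbol) (q : ι) :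
    y q = rootPart root y q +
      upPart up y q * HahnSeries.single ((0, -1) : ℤ × ℤ) (1 : ℂ) -
      ∑ k, lowPart B up p a y k * leadTerm B p a q k := by
  classical
  obtain ⟨k, rfl⟩ := h.bij.surjective q
  rw [Finset.sum_eq_single k (fun l _ hl => by
    rw [leadTerm, if_neg fun e => hl (h.bij.injective e).symm, mul_zero]) (by simp)]
  ext ⟨j, i⟩
  have hne := h.lead_ne k (j - a k)
  rw [leadTerm, if_pos rfl, HahnSeries.coeff_sub, HahnSeries.coeff_add,
    HahnSeries.coeff_mul_single, HahnSeries.coeff_mul_single, coeff_rootPart]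
  simp only [Prod.mk_sub_mk, coeff_upPart, coeff_lowPart, sub_zero, sub_neg_eq_add,
    add_sub_cancel_right, sub_add_cancel, mul_one]
  rcases h.cover k j with ⟨h1, h2, h3⟩ | ⟨h1, h2, h3⟩ | ⟨h1, h2, h3⟩
  · simp [h1, h2, h3]
  · have := hne h2
    simp only [h1, h2, h3, if_true, if_false, not_false_eq_true]
    field_simp
    ring
  · rw [if_pos h3, if_neg h1, if_neg (not_not.2 h2)]
    simp

/-- Four errors remain after the leading terms cancel: the `∂`-terms of relations led by `B`, the
`B`-terms of relations led by `∂`, the noncommutative corrections, and the nonleading terms of `B`.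
-/
theorem defect_eq (h : LeadingChoice B D ω up p a root) (y : ι → MicroSymbol) (q : ι) :
    defect B up p a root y q =
      -(lowPart B up p a y q * HahnSeries.single ((0, -1) : ℤ × ℤ) (1 : ℂ)) +
      ∑ k, star (upPart up y k) (ofW (B q k)) +
      ∑ k, (star (lowPart B up p a y k) (ofW (B q k)) - lowPart B up p a y k * ofW (B q k)) +
      ∑ k, lowPart B up p a y k * (ofW (B q k) - leadTerm B p a q k) := by
  rw [defect_apply, Pi.sub_apply, Pi.add_apply, relComb_apply]
  conv_lhs => enter [1]; rw [h.leading_division y q]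
  simp only [Pi.add_apply, add_mul, mul_sub, star_add_left, Finset.sum_add_distrib,
    Finset.sum_sub_distrib]
  abel

/-- Each of the four errors in `defect_eq` falls under one of the hypotheses `raises_low`,
`raises_up`, `raises_err`, the last serving both for corrections and for nonleading terms. -/
theorem raisesSupport_defect (h : LeadingChoice B D ω up p a root) :
    RaisesSupport D ω (defect B up p a root) := by
  classical
  have hlow : ∀ (y : ι → MicroSymbol) k (r : ℤ × ℤ), (lowPart B up p a y k).coeff r ≠ 0 →
      ¬ up k r.1 ∧ (y (p k)).coeff (r.1 + a k, r.2) ≠ 0 := by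
    rintro y k ⟨j, i⟩ hr
    rw [coeff_lowPart] at hr
    by_cases hu : up k j
    · simp [hu] at hr
    · rw [if_pos hu] at hr
      exact ⟨hu, right_ne_zero_of_mul hr⟩
  intro y q r hr
  rw [h.defect_eq] at hr
  simp only [HahnSeries.coeff_add, HahnSeries.coeff_neg, HahnSeries.coeff_sum] at hr
  by_cases h4 : ∑ k, (lowPart B up p a y k * (ofW (B q k) - leadTerm B p a q k)).coeff r = 0
  · rw [h4, add_zero] at hr
    by_cases h3 : ∑ k, (star (lowPart B up p a y k) (ofW (B q k)) -
        lowPart B up p a y k * ofW (B q k)).coeff r = 0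
    · rw [h3, add_zero] at hr
      by_cases h2 : ∑ k, (star (upPart up y k) (ofW (B q k))).coeff r = 0
      · rw [h2, add_zero, neg_ne_zero, HahnSeries.coeff_mul_single] at hr
        obtain ⟨hu, hy⟩ := hlow _ _ _ (left_ne_zero_of_mul hr)
        refine ⟨_, _, hy, ?_⟩
        have := h.raises_low q _ (r - (0, -1)).2 hu
        simpa using this
      · obtain ⟨k, -, hk⟩ := Finset.exists_ne_zero_of_sum_ne_zero h2
        obtain ⟨⟨j, i⟩, ⟨c, d⟩, l, h1, hc, rfl⟩ := coeff_star_exists hk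
        obtain ⟨rfl, hc⟩ := coeff_ofW_ne hc
        rw [coeff_upPart] at h1
        split_ifs at h1 with hu
        · refine ⟨_, _, h1, ?_⟩
          simpa using h.raises_up k q j (i - 1) c l hu hc
        · exact (h1 rfl).elim
    · obtain ⟨k, -, hk⟩ := Finset.exists_ne_zero_of_sum_ne_zero h3
      obtain ⟨⟨j, i⟩, ⟨c, d⟩, l, hl, h1, hc, rfl⟩ := coeff_star_sub_mul_exists hk
      obtain ⟨rfl, hc⟩ := coeff_ofW_ne hc
      obtain ⟨hu, hy⟩ := hlow _ _ _ h1
      refine ⟨_, _, hy, ?_⟩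
      simpa using h.raises_err k q j i c l hu hc (.inl hl)
  · obtain ⟨k, -, hk⟩ := Finset.exists_ne_zero_of_sum_ne_zero h4
    obtain ⟨⟨j, i⟩, h1, ⟨c, d⟩, hc, rfl⟩ := HahnSeries.support_mul_subset hk
    obtain ⟨hu, hy⟩ := hlow _ _ _ h1
    refine ⟨_, _, hy, ?_⟩
    have hc' : (ofW (B q k) - leadTerm B p a q k).coeff (c, d) ≠ 0 := hc
    rw [HahnSeries.coeff_sub, coeff_ofW, leadTerm] at hc'
    have key : d = 0 ∧ (B q k).coeff c ≠ 0 ∧ (q ≠ p k ∨ c ≠ a k) := by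
      by_cases hd : d = 0
      · subst hd
        by_cases hq : q = p k
        · subst hq
          by_cases hca : c = a k
          · subst hca
            simp at hc'
          · simp [hca] at hc'
            exact ⟨rfl, hc', .inr hca⟩
        · simp [hq] at hc'
          exact ⟨rfl, hc', .inl hq⟩
      · exfalso
        split_ifs at hc' <;> simp [hd] at hc'
    obtain ⟨rfl, hc, hne⟩ := key
    simpa using h.raises_err k q j i c 0 hu hc (.inr hne)

/-- Every vector is congruent to one with constant root components modulo the relations. -/
theorem exists_division (h : LeadingChoice B D ω up p a root) (y : ι → MicroSymbol) :
    ∃ C x : ι → MicroSymbol, (∀ q r, (C q).coeff r ≠ 0 → r.1 = 0 ∧ root q) ∧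
      y = C + relComb B x := by
  -- Dividing `s = ∑ Tⁿ y`, with `T` the defect, instead of `y` absorbs all errors: the leading
  -- remainder and quotient of `s` divide `y` exactly.
  obtain ⟨s, hs⟩ := h.raisesSupport_defect.exists_sub_eq h.nonneg h.mono y
  refine ⟨rootPart root s, upPart up s + lowPart B up p a s, fun q r hr => (coeff_cut_ne hr).1, ?_⟩
  rw [← hs, defect_apply]
  abel

/-- A vanishing combination of a remainder and relations produces a fixed vector of the defect,
which must be zero. -/
theorem division_unique (h : LeadingChoice B D ω up p a root) {C x : ι → MicroSymbol}
    (hC : ∀ q r, (C q).coeff r ≠ 0 → r.1 = 0 ∧ root q) (h0 : C + relComb B x = 0) : C = 0 := by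
  classical
  -- The sum of `C` and the leading terms of the combination `x`, built so that leading division of
  -- `y` returns `C` as remainder and `x` as quotient.
  let y : ι → MicroSymbol := fun q => C q +
      cut (up q) (x q) * HahnSeries.single ((0, -1) : ℤ × ℤ) (1 : ℂ) -
      ∑ k, cut (fun j => ¬ up k j) (x k) * leadTerm B p a q k
  have hy : ∀ k j i, (y (p k)).coeff (j, i) = if up (p k) j then (x (p k)).coeff (j, i + 1) else
      if ¬ up k (j - a k) then -((B (p k) k).coeff (a k)) * (x k).coeff (j - a k, i) else
      (C (p k)).coeff (j, i) := by
    intro k j i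
    simp only [y]
    rw [Finset.sum_eq_single k (fun l _ hl => by
      rw [leadTerm, if_neg fun e => hl (h.bij.injective e).symm, mul_zero]) (by simp)]
    rw [leadTerm, if_pos rfl, HahnSeries.coeff_sub, HahnSeries.coeff_add,
      HahnSeries.coeff_mul_single, HahnSeries.coeff_mul_single]
    simp only [Prod.mk_sub_mk, coeff_cut, sub_zero, sub_neg_eq_add, mul_one]
    have hC' : (C (p k)).coeff (j, i) = 0 ∨ (j = 0 ∧ root (p k)) := by
      by_contra! hne
      exact hne.2 (hC _ _ hne.1).1 (hC _ _ hne.1).2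
    rcases h.cover k j with ⟨h1, h2, h3⟩ | ⟨h1, h2, h3⟩ | ⟨h1, h2, h3⟩
    · simp [h1, h2, hC'.resolve_right h3]
    · simp [h1, h2, hC'.resolve_right h3, mul_comm]
    · simp [h1, h2]
  have hroot : rootPart root y = C := by
    ext q ⟨j, i⟩
    obtain ⟨k, rfl⟩ := h.bij.surjective q
    rw [coeff_rootPart, hy]
    have hC' : (C (p k)).coeff (j, i) = 0 ∨ (j = 0 ∧ root (p k)) := by
      by_contra! hne
      exact hne.2 (hC _ _ hne.1).1 (hC _ _ hne.1).2
    rcases h.cover k j with ⟨h1, h2, h3⟩ | ⟨h1, h2, h3⟩ | ⟨h1, h2, h3⟩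
    · rw [if_neg h3, hC'.resolve_right h3]
    · rw [if_neg h3, hC'.resolve_right h3]
    · rw [if_pos h3, if_neg h1, if_neg (not_not.2 h2)]
  have hquot : upPart up y + lowPart B up p a y = x := by
    ext k ⟨j, i⟩
    rw [Pi.add_apply, HahnSeries.coeff_add, coeff_upPart, coeff_lowPart]
    by_cases hu : up k j
    · rw [if_pos hu, if_neg (not_not.2 hu), add_zero]
      obtain ⟨l, rfl⟩ := h.bij.surjective k
      rw [hy, if_pos hu, sub_add_cancel]
    · have hne := h.lead_ne k j hu
      rw [if_neg hu, if_pos hu, zero_add, hy]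
      rcases h.cover k (j + a k) with ⟨h1, h2, h3⟩ | ⟨h1, h2, h3⟩ | ⟨h1, h2, h3⟩
      · rw [add_sub_cancel_right] at h2
        exact (hu h2).elim
      · rw [if_neg h1, if_pos h2, add_sub_cancel_right]
        field_simp
      · rw [add_sub_cancel_right] at h2
        exact (hu h2).elim
  have hfix : defect B up p a root y = y := by
    rw [defect_apply, hroot, hquot, h0, sub_zero]
  rw [← hroot, h.raisesSupport_defect.eq_zero h.nonneg h.mono hfix]
  ext1 q
  simp [rootPart]

end LeadingChoice

end Division

end MicroSymbol

/-! ### Laurent series in `w` as microdifferential operators -/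

/-- The derivation `∂/∂z = -w² ∂/∂w` of `ℂ((w))`. -/
noncomputable def LaurentSeries.derivZ (f : ℂ⸨X⸩) : ℂ⸨X⸩ :=
  (HahnSeries.single (2 : ℤ) (-1 : ℂ) : ℂ⸨X⸩) * LaurentSeries.derivative ℂ f

theorem LaurentSeries.coeff_derivZ (f : ℂ⸨X⸩) (n : ℤ) :
    (LaurentSeries.derivZ f).coeff n = -((n : ℂ) - 1) * f.coeff (n - 1) := by
  rw [derivZ, HahnSeries.coeff_single_mul, derivative_apply,
    hasseDeriv_coeff]
  simp only [Nat.cast_one, Ring.choose_one_right, zsmul_eq_mul]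
  rw [show n - 2 + 1 = n - 1 by ring]
  push_cast
  ring

namespace MicroInfty

theorem dzhat_ofW (f : ℂ⸨X⸩) : MicroSymbol.dzhat (MicroSymbol.ofW f) = 0 := by
  ext ⟨j, i⟩
  rw [MicroSymbol.coeff_dzhat, MicroSymbol.coeff_ofW]
  by_cases h : i = 1
  · simp [h]
  · rw [if_neg (by simpa [sub_eq_zero] using h)]
    simp

theorem dz_ofW (f : ℂ⸨X⸩) :
    MicroSymbol.dz (MicroSymbol.ofW f) = MicroSymbol.ofW (derivZ f) := by
  ext ⟨j, i⟩
  rw [MicroSymbol.coeff_dz, MicroSymbol.coeff_ofW, MicroSymbol.coeff_ofW, coeff_derivZ]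
  simp

/-- The inclusion of `ℂ((w))` into `E_∞[w⁻¹]`. -/
noncomputable def ofLaurentW : ℂ⸨X⸩ →+* MicroInfty where
  toFun f := ofSymbol (MicroSymbol.ofW f)
  map_one' := by rw [map_one, ofSymbol_one]
  map_zero' := by rw [map_zero, map_zero]
  map_add' f g := by rw [map_add, map_add]
  map_mul' f g := by
    rw [ofSymbol_mul, MicroSymbol.star_eq_mul_of_dzhat (dzhat_ofW f), map_mul]

theorem ofLaurentW_apply (f : ℂ⸨X⸩) : ofLaurentW f = ofSymbol (MicroSymbol.ofW f) := rfl

/-- The operator `∂_z = ŵ⁻¹`. -/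
noncomputable def partialZ : MicroInfty := monomial 0 (-1)

/-- The symbol of `∂_z` has degree one in `ẑ`, so the product series stops after its first two terms
and gives the Leibniz rule. -/
theorem partialZ_mul_ofLaurentW (f : ℂ⸨X⸩) :
    partialZ * ofLaurentW f = ofLaurentW f * partialZ + ofLaurentW (derivZ f) := by
  have h3 : ∀ k : ℕ, 2 ≤ k → MicroSymbol.dzhat^[k]
      (HahnSeries.single ((0, -1) : ℤ × ℤ) (1 : ℂ)) = 0 := by
    intro k hk
    obtain ⟨k, rfl⟩ := Nat.exists_eq_add_of_le' hk
    rw [Function.iterate_add_apply]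
    simp [dzhat_single, iterate_map_zero]
  rw [partialZ, monomial, ofLaurentW_apply, ofLaurentW_apply, ofSymbol_mul, ofSymbol_mul,
    MicroSymbol.star_eq_mul_of_dzhat (dzhat_ofW f), ← dz_ofW, ← map_add]
  congr 1
  ext p
  refine (finsum_eq_sum_of_support_subset (s := Finset.range 2) _ fun k hk => ?_).trans ?_
  · simp only [Finset.coe_range, Set.mem_Iio]
    by_contra hlt
    refine hk ?_
    simp [MicroSymbol.term, MicroSymbol.bidiff, h3 k (by omega)]
  · have h1 : (HahnSeries.single ((0, 0) : ℤ × ℤ) (1 : ℂ) : MicroSymbol) = 1 := rfl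
    simp [Finset.sum_range_succ, MicroSymbol.term, MicroSymbol.bidiff, dzhat_single, h1, mul_comm]

/-- The expansion at infinity of a polynomial in `z`. -/
noncomputable def expandInfty : ℂ[X] →+* ℂ⸨X⸩ :=
  Polynomial.eval₂RingHom HahnSeries.C (HahnSeries.single (-1 : ℤ) (1 : ℂ) : ℂ⸨X⸩)

theorem expandInfty_monomial (n : ℕ) (c : ℂ) :
    expandInfty (Polynomial.monomial n c) = HahnSeries.single (-n : ℤ) c := by
  rw [expandInfty, coe_eval₂RingHom, eval₂_monomial, HahnSeries.single_pow, HahnSeries.C_apply,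
    HahnSeries.single_mul_single]
  simp

theorem expandInfty_X : expandInfty X = HahnSeries.single (-1 : ℤ) (1 : ℂ) := by
  rw [expandInfty, coe_eval₂RingHom, eval₂_X]

theorem derivZ_expandInfty (f : ℂ[X]) : derivZ (expandInfty f) = expandInfty (derivative f) := by
  induction f using Polynomial.induction_on' with
  | add f g hf hg =>
    rw [map_add, derivative_add, map_add, ← hf, ← hg, derivZ, derivZ, derivZ, map_add, mul_add]
  | monomial n c =>
    rw [derivative_monomial, expandInfty_monomial, expandInfty_monomial]
    ext m
    rw [coeff_derivZ, HahnSeries.coeff_single, HahnSeries.coeff_single]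
    by_cases hn : n = 0
    · subst hn
      by_cases hm : m = 1
      · simp [hm]
      · rw [if_neg (by simpa [sub_eq_zero] using hm)]
        simp
    · have e : (m - 1 = -(n : ℤ)) ↔ m = -((n - 1 : ℕ) : ℤ) := by omega
      by_cases hm : m - 1 = -(n : ℤ)
      · rw [if_pos hm, if_pos (e.1 hm)]
        have : (m : ℂ) - 1 = -n := by exact_mod_cast hm
        rw [this]
        ring
      · rw [if_neg hm, if_neg (mt e.2 hm), mul_zero]

theorem ofWeyl_z : ofWeyl WeylAlgebra.z = ofLaurentW (HahnSeries.single (-1 : ℤ) (1 : ℂ)) := by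
  rw [ofWeyl, WeylAlgebra.lift_z, ofLaurentW_apply, monomial]
  congr 1
  ext ⟨j, i⟩
  rw [MicroSymbol.coeff_ofW, HahnSeries.coeff_single, HahnSeries.coeff_single]
  simp only [Prod.mk.injEq]
  split_ifs <;> tauto

theorem ofWeyl_d : ofWeyl WeylAlgebra.d = partialZ := WeylAlgebra.lift_d _ _ _

theorem ofWeyl_aeval_z (f : ℂ[X]) :
    ofWeyl (aeval WeylAlgebra.z f) = ofLaurentW (expandInfty f) := by
  induction f using Polynomial.induction_on with
  | C c =>
    rw [aeval_C, AlgHom.commutes, expandInfty, coe_eval₂RingHom, eval₂_C, ofLaurentW_apply,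
      Algebra.algebraMap_eq_smul_one, ← ofSymbol_one, ← map_smul]
    congr 1
    ext ⟨j, i⟩
    rw [MicroSymbol.coeff_ofW, HahnSeries.C_apply, HahnSeries.coeff_single, HahnSeries.coeff_smul,
      HahnSeries.coeff_one]
    simp only [Prod.mk_eq_zero, smul_eq_mul, mul_ite, mul_one, mul_zero]
    split_ifs <;> tauto
  | add f g hf hg => simp only [map_add, hf, hg]
  | monomial n c ih =>
    rw [pow_succ, ← mul_assoc, map_mul, map_mul, ih, aeval_X, ofWeyl_z, expandInfty.map_mul (C c * X ^ n) X,
      expandInfty_X]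
    exact (map_mul ofLaurentW _ _).symm

end MicroInfty

theorem WeylAlgebra.induction {P : WeylAlgebra → Prop} (hC : ∀ c : ℂ, P (algebraMap ℂ _ c))
    (hz : P WeylAlgebra.z) (hd : P WeylAlgebra.d) (hmul : ∀ a b, P a → P b → P (a * b))
    (hadd : ∀ a b, P a → P b → P (a + b)) (x : WeylAlgebra) : P x := by
  obtain ⟨y, rfl⟩ := RingQuot.mkAlgHom_surjective ℂ WeylRel x
  induction y using FreeAlgebra.induction with
  | grade0 c => rw [AlgHom.commutes]; exact hC c
  | grade1 i => fin_cases i; exacts [hz, hd]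
  | mul a b ha hb => rw [map_mul]; exact hmul _ _ ha hb
  | add a b ha hb => rw [map_add]; exact hadd _ _ ha hb

/-! ### Presentation of the microlocalization of a connection -/

open MicroInfty Matrix

/-- The matrix `∂ - Bᵀ` over `E_∞[w⁻¹]`: its rows are the relations `∂ e_k = ∑_q B_qk e_q`. -/
noncomputable def relMatrix {ι : Type*} [DecidableEq ι] (B : Matrix ι ι ℂ⸨X⸩) :
    Matrix ι ι MicroInfty :=
  diagonal (fun _ => partialZ) - Bᵀ.map ofLaurentW

section RelMatrix

variable {ι : Type*} [DecidableEq ι] [Fintype ι]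

theorem vecMul_relMatrix (B : Matrix ι ι ℂ⸨X⸩) (x : ι → MicroInfty) (q : ι) :
    (x ᵥ* relMatrix B) q = x q * partialZ - ∑ k, x k * ofLaurentW (B q k) := by
  rw [relMatrix, vecMul_sub, Pi.sub_apply, vecMul_diagonal]
  rfl

theorem vecMul_relMatrix_ofSymbol (B : Matrix ι ι ℂ⸨X⸩) (x : ι → MicroSymbol) :
    (fun k => ofSymbol (x k)) ᵥ* relMatrix B =
      fun k => ofSymbol (MicroSymbol.relComb B x k) := by
  ext1 q
  rw [vecMul_relMatrix, MicroSymbol.relComb_apply, map_sub, map_sum]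
  congr 1
  rw [partialZ, MicroInfty.monomial, ofSymbol_mul, MicroSymbol.star_eq_mul_of_dz _ (by simp [dz_single])]

/-- Change of frame: `G` transforms the connection matrix `A` into `B`. -/
theorem gauge_mul_relMatrix {A B G : Matrix ι ι ℂ⸨X⸩} (h : G.map derivZ + A * G = G * B) :
    Gᵀ.map ofLaurentW * relMatrix A = relMatrix B * Gᵀ.map ofLaurentW := by
  have h1 : (diagonal (fun _ => partialZ) : Matrix ι ι MicroInfty) * Gᵀ.map ofLaurentW =
      Gᵀ.map ofLaurentW * diagonal (fun _ => partialZ) + (G.map derivZ)ᵀ.map ofLaurentW := by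
    ext i j
    simp only [diagonal_mul, mul_diagonal, Matrix.add_apply, map_apply, transpose_apply]
    -- Moving `∂` past the entries of `G` produces the derivative term of the gauge formula.
    exact partialZ_mul_ofLaurentW _
  have h2 : G.map derivZ = G * B - A * G := by rw [← h, add_sub_cancel_right]
  rw [relMatrix, relMatrix, mul_sub, sub_mul, h1, h2, transpose_sub, transpose_mul, transpose_mul,
    Matrix.map_sub ofLaurentW (fun _ _ => map_sub _ _ _), Matrix.map_mul, Matrix.map_mul]
  abel

end RelMatrix

/-! ### Sections over the affine line in the standard frame -/

namespace ConnectionModule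

variable {n : ℕ} {A : Matrix (Fin n) (Fin n) ℂ[X]}

variable (A) in
/-- The section with given components. -/
def ofFun (v : Fin n → ℂ[X]) : ConnectionModule A := v

theorem ofFun_apply (v : Fin n → ℂ[X]) (i : Fin n) : ofFun A v i = v i := rfl

theorem add_apply (v v' : ConnectionModule A) (i : Fin n) : (v + v') i = v i + v' i := rfl

theorem ext {v v' : ConnectionModule A} (h : ∀ i, v i = v' i) : v = v' := funext h

theorem aeval_z_smul (f : ℂ[X]) (v : ConnectionModule A) (i : Fin n) :
    (aeval WeylAlgebra.z f • v) i = f * v i := by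
  induction f using Polynomial.induction_on generalizing v with
  | C c =>
    rw [aeval_C]
    change ((WeylAlgebra.lift mulZ (nabla A) (nabla_mulZ A) (algebraMap ℂ WeylAlgebra c) :
      Module.End ℂ (Fin n → ℂ[X])) v) i = _
    rw [AlgHom.commutes]
    exact smul_eq_C_mul (p := v i) c
  | add f g hf hg => rw [map_add, add_smul, add_apply, hf, hg, add_mul]
  | monomial k c ih =>
    rw [pow_succ, ← mul_assoc, map_mul, mul_smul, ih, aeval_X, z_smul]
    ring

variable (A) in
/-- The standard frame of the module of sections. -/
noncomputable def stdFrame (i : Fin n) : ConnectionModule A := ofFun A (Pi.single i 1)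

theorem stdFrame_apply (i j : Fin n) :
    stdFrame A i j = (Pi.single i 1 : Fin n → ℂ[X]) j := rfl

theorem sum_aeval_smul_stdFrame (v : ConnectionModule A) :
    ∑ i, aeval WeylAlgebra.z (v i) • stdFrame A i = v := by
  have h : ∀ i, aeval WeylAlgebra.z (v i) • stdFrame A i = ofFun A (Pi.single i (v i)) := by
    refine fun i => ext fun j => ?_
    rw [aeval_z_smul, stdFrame_apply, ofFun_apply]
    by_cases hj : j = i
    · subst hj; simp
    · simp [hj]
  rw [Finset.sum_congr rfl fun i _ => h i]
  exact Finset.univ_sum_single (M := fun _ => ℂ[X]) v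

theorem d_smul_stdFrame (k : Fin n) : WeylAlgebra.d • stdFrame A k = ofFun A (fun i => A i k) := by
  refine ext fun i => ?_
  have h1 : derivative (stdFrame A k i) = 0 := by
    rw [stdFrame_apply]
    by_cases hi : i = k
    · subst hi; simp
    · simp [hi]
  rw [d_smul, h1, zero_add]
  exact congrFun (mulVec_single_one A k) i

end ConnectionModule

/-! ### The microlocalization as the cokernel of the relation matrix -/

namespace MicrolocalizationInfty

/-- The class of `s ⊗ m`. -/
noncomputable def tmul {M : Type*} [AddCommGroup M] [Module WeylAlgebra M] (s : MicroInfty)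
    (m : M) : MicrolocalizationInfty M :=
  (microRelations M).mkQ (s ⊗ₜ[ℤ] m)

section Basic

variable {M : Type*} [AddCommGroup M] [Module WeylAlgebra M]

theorem smul_tmul (s t : MicroInfty) (m : M) : s • tmul t m = tmul (s * t) m := rfl

theorem tmul_add (s : MicroInfty) (m m' : M) : tmul s (m + m') = tmul s m + tmul s m' := by
  rw [tmul, TensorProduct.tmul_add, map_add]
  rfl

theorem tmul_sum {κ : Type*} (t : Finset κ) (s : MicroInfty) (m : κ → M) :
    tmul s (∑ i ∈ t, m i) = ∑ i ∈ t, tmul s (m i) :=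
  map_sum (AddMonoidHom.mk' (fun m : M => tmul s m) (tmul_add s)) m t

theorem tmul_smul (s : MicroInfty) (d : WeylAlgebra) (m : M) :
    tmul s (d • m) = tmul (s * ofWeyl d) m :=
  ((Submodule.Quotient.eq (microRelations M)).2 (Submodule.subset_span ⟨s, d, m, rfl⟩)).symm

theorem induction_on {P : MicrolocalizationInfty M → Prop} (h0 : P 0)
    (htmul : ∀ s m, P (tmul s m)) (hadd : ∀ x y, P x → P y → P (x + y))
    (x : MicrolocalizationInfty M) : P x := by
  obtain ⟨x, rfl⟩ := (microRelations M).mkQ_surjective x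
  induction x using TensorProduct.induction_on with
  | zero => exact h0
  | tmul s m => exact htmul s m
  | add x y hx hy => exact hadd _ _ hx hy

/-- An additive map compatible with the actions of the Weyl algebra extends to the
microlocalization. -/
noncomputable def lift {Q : Type*} [AddCommGroup Q] [Module MicroInfty Q] (ψ : M →+ Q)
    (hψ : ∀ (d : WeylAlgebra) m, ψ (d • m) = ofWeyl d • ψ m) :
    MicrolocalizationInfty M →ₗ[MicroInfty] Q :=
  (microRelations M).liftQ
    (TensorProduct.AlgebraTensorModule.lift
      (LinearMap.toSpanSingleton MicroInfty (M →ₗ[ℤ] Q) ψ.toIntLinearMap)) (by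
    rw [microRelations, Submodule.span_le]
    rintro _ ⟨s, d, m, rfl⟩
    simp [hψ, mul_smul])

theorem lift_tmul {Q : Type*} [AddCommGroup Q] [Module MicroInfty Q] (ψ : M →+ Q)
    (hψ : ∀ (d : WeylAlgebra) m, ψ (d • m) = ofWeyl d • ψ m) (s : MicroInfty) (m : M) :
    lift ψ hψ (tmul s m) = s • ψ m := rfl

end Basic

variable {n : ℕ} (A : Matrix (Fin n) (Fin n) ℂ[X])

open ConnectionModule

/-- The map `x ↦ ∑ x_i ⊗ e_i`. -/
noncomputable def combFrame :
    (Fin n → MicroInfty) →ₗ[MicroInfty] MicrolocalizationInfty (ConnectionModule A) :=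
  Fintype.linearCombination MicroInfty (fun i => tmul 1 (stdFrame A i))

theorem combFrame_apply (x : Fin n → MicroInfty) :
    combFrame A x = ∑ i, tmul (x i) (stdFrame A i) := by
  simp [combFrame, Fintype.linearCombination_apply, smul_tmul]

theorem tmul_eq_combFrame (s : MicroInfty) (v : ConnectionModule A) :
    tmul s v = combFrame A (fun i => s * ofLaurentW (expandInfty (v i))) := by
  conv_lhs => rw [← sum_aeval_smul_stdFrame v]
  rw [tmul_sum, combFrame_apply]
  refine Finset.sum_congr rfl fun i _ => ?_
  rw [tmul_smul, ofWeyl_aeval_z]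

theorem combFrame_surjective : Function.Surjective (combFrame A) := by
  intro x
  induction x using induction_on with
  | h0 => exact ⟨0, map_zero _⟩
  | htmul s m => exact ⟨_, (tmul_eq_combFrame A s m).symm⟩
  | hadd x y hx hy =>
    obtain ⟨x, rfl⟩ := hx
    obtain ⟨y, rfl⟩ := hy
    exact ⟨x + y, map_add _ _ _⟩

/-- A row of the relation matrix is `∂ e_k = ∑ A_ik e_i`, which holds after moving `∂` across the
tensor sign. -/
theorem combFrame_vecMul_relMatrix (u : Fin n → MicroInfty) :
    combFrame A (u ᵥ* relMatrix (A.map expandInfty)) = 0 := by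
  have h : ∀ k, combFrame A (relMatrix (A.map expandInfty) k) = 0 := by
    intro k
    have h1 : combFrame A (fun i => diagonal (fun _ => partialZ) k i) =
        combFrame A (fun i => ofLaurentW (expandInfty (A i k))) := by
      have h2 : tmul partialZ (stdFrame A k) =
          combFrame A (fun i => ofLaurentW (expandInfty (A i k))) := by
        rw [← one_mul partialZ, ← ofWeyl_d, ← tmul_smul, d_smul_stdFrame, tmul_eq_combFrame]
        simp only [one_mul]
        rfl
      refine Eq.trans ?_ h2
      rw [combFrame_apply, Finset.sum_eq_single k]
      · simp
      · intro i _ hi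
        rw [diagonal_apply_ne _ hi.symm, tmul, TensorProduct.zero_tmul, map_zero]
        rfl
      · simp
    have h3 : relMatrix (A.map expandInfty) k = (fun i => diagonal (fun _ => partialZ) k i) -
        (fun i => ofLaurentW (expandInfty (A i k))) := rfl
    rw [h3, map_sub, h1, sub_self]
  have h4 : u ᵥ* relMatrix (A.map expandInfty) = ∑ k, u k • relMatrix (A.map expandInfty) k := by
    ext1 i
    simp [vecMul, dotProduct]
  rw [h4, map_sum]
  simp [h]

/-- The map of sections to the cokernel of the relations. -/
noncomputable def toCokernel : ConnectionModule A →+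
    (Fin n → MicroInfty) ⧸ LinearMap.range (relMatrix (A.map expandInfty)).vecMulLinear :=
  AddMonoidHom.mk' (fun v => Submodule.mkQ _ (fun i => ofLaurentW (expandInfty (v i)))) (by
    intro v v'
    rw [← map_add]
    congr 1
    ext1 i
    exact (congrArg ofLaurentW (map_add expandInfty _ _)).trans (map_add ofLaurentW _ _))

theorem toCokernel_apply (v : ConnectionModule A) :
    toCokernel A v = Submodule.mkQ _ (fun i => ofLaurentW (expandInfty (v i))) := rfl

theorem toCokernel_smul (d : WeylAlgebra) (v : ConnectionModule A) :
    toCokernel A (d • v) = ofWeyl d • toCokernel A v := by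
  induction d using WeylAlgebra.induction generalizing v with
  | hC c =>
    have h1 : algebraMap ℂ WeylAlgebra c = aeval WeylAlgebra.z (C c : ℂ[X]) := by rw [aeval_C]
    rw [h1, ofWeyl_aeval_z, toCokernel_apply, toCokernel_apply, ← map_smul]
    congr 1
    ext1 i
    rw [aeval_z_smul, map_mul, map_mul]
    rfl
  | hz =>
    rw [ofWeyl_z, toCokernel_apply, toCokernel_apply, ← map_smul]
    congr 1
    ext1 i
    rw [ConnectionModule.z_smul, map_mul, map_mul, expandInfty_X]
    rfl
  | hd =>
    rw [ofWeyl_d, toCokernel_apply, toCokernel_apply, ← map_smul, eq_comm]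
    -- By Leibniz `∂ v - (v' + A v)` equals `v ∂ - A v` in normal form, which is the combination of
    -- the relations with coefficients `v`.
    refine (Submodule.Quotient.eq _).2 ⟨fun i => ofLaurentW (expandInfty (v i)), ?_⟩
    ext1 q
    have h1 : A.mulVec v q = ∑ k, A q k * v k := rfl
    rw [vecMulLinear_apply, vecMul_relMatrix, Pi.sub_apply, Pi.smul_apply, smul_eq_mul,
      partialZ_mul_ofLaurentW, derivZ_expandInfty, ConnectionModule.d_smul, map_add, map_add, h1,
      map_sum, map_sum]
    have h2 : ∀ k, ofLaurentW (expandInfty (A q k * v k)) =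
        ofLaurentW (expandInfty (v k)) * ofLaurentW (expandInfty (A q k)) := fun k => by
      rw [mul_comm, map_mul, map_mul]
    simp only [h2, map_apply]
    abel
  | hmul a b ha hb => rw [mul_smul, ha, hb, map_mul, mul_smul]
  | hadd a b ha hb => rw [add_smul, map_add, ha, hb, map_add, add_smul]

/-- There are no further relations: `toCokernel` is linear over the Weyl algebra, so it extends to
the microlocalization, and the extension sends `∑ x_i ⊗ e_i` back to the class of `x`. -/
theorem combFrame_eq_zero {x : Fin n → MicroInfty} (hx : combFrame A x = 0) :
    ∃ u, u ᵥ* relMatrix (A.map expandInfty) = x := by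
  have h1 : lift (toCokernel A) (toCokernel_smul A) (combFrame A x) = Submodule.mkQ _ x := by
    have h2 : ∀ i, toCokernel A (stdFrame A i) =
        Submodule.mkQ _ (Pi.single i (1 : MicroInfty)) := by
      intro i
      rw [toCokernel_apply]
      congr 1
      ext1 j
      by_cases hj : j = i
      · subst hj; simp [stdFrame_apply]
      · simp [stdFrame_apply, hj]
    rw [combFrame_apply, map_sum]
    simp only [lift_tmul, h2, ← map_smul, ← map_sum]
    congr 1
    ext1 j
    simp [Finset.sum_apply, Pi.single_apply]
  rw [hx, map_zero, eq_comm, Submodule.mkQ_apply, Submodule.Quotient.mk_eq_zero] at h1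
  exact h1

end MicrolocalizationInfty

/-! ### The rank of the microlocalization -/

namespace MicroInfty

theorem ofLaurent_eq {f : ℂ⸨X⸩} {C : MicroSymbol} (h : ∀ r, C.coeff r ≠ 0 → r.1 = 0)
    (hf : ∀ i, f.coeff i = C.coeff (0, i)) : ofLaurent f = ofSymbol C := by
  change ofSymbol (HahnSeries.embDomainRingHom _ _ _ f) = _
  congr 1
  ext ⟨j, i⟩
  by_cases hj : j = 0
  · subst hj
    rw [← hf]
    exact HahnSeries.embDomain_coeff (f := ⟨⟨AddMonoidHom.inr ℤ ℤ, _⟩, _⟩) (a := i)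
  · rw [show C.coeff (j, i) = 0 from not_not.1 fun hne => hj (h _ hne)]
    refine HahnSeries.embDomain_of_notMem_range ?_
    rintro ⟨c, hc⟩
    exact hj (Prod.ext_iff.1 hc).1.symm

/-- A symbol constant in `w` has only powers of `ŵ`, bounded below because its support lies in a
quadrant. This identifies the remainders of the division with scalars. -/
theorem exists_ofLaurent_eq {C : MicroSymbol} (h : ∀ r, C.coeff r ≠ 0 → r.1 = 0) :
    ∃ f : ℂ⸨X⸩, ofLaurent f = ofSymbol C := by
  obtain ⟨m, hm⟩ := MicroSymbol.exists_bound C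
  refine ⟨HahnSeries.ofSuppBddBelow (fun i => C.coeff (0, i)) ⟨m, fun i hi => (hm _ hi).2⟩,
    ofLaurent_eq h fun i => congrFun HahnSeries.coeff_ofSuppBddBelow i⟩

theorem coeff_ofLaurent_ne {f : ℂ⸨X⸩} {r : ℤ × ℤ}
    (h : (ofSymbol.symm (ofLaurent f)).coeff r ≠ 0) : r.1 = 0 := by
  by_contra hne
  refine h (HahnSeries.embDomain_of_notMem_range ?_)
  rintro ⟨c, rfl⟩
  exact hne rfl

instance : Nontrivial MicroInfty := inferInstanceAs (Nontrivial MicroSymbol)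

theorem ofLaurent_injective : Function.Injective ofLaurent := ofLaurent.injective

end MicroInfty

namespace MicrolocalizationInfty

open MicroSymbol

variable {n : ℕ} {A : Matrix (Fin n) (Fin n) ℂ[X]} {B : Matrix (Fin n) (Fin n) ℂ⸨X⸩}

/-- The combinations of the formal frame given by the columns of `G`. -/
noncomputable def combGauge (A : Matrix (Fin n) (Fin n) ℂ[X]) (G : Matrix (Fin n) (Fin n) ℂ⸨X⸩) :
    (Fin n → MicroInfty) →ₗ[MicroInfty] MicrolocalizationInfty (ConnectionModule A) :=
  combFrame A ∘ₗ (Gᵀ.map ofLaurentW).vecMulLinear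

theorem combGauge_apply (G : Matrix (Fin n) (Fin n) ℂ⸨X⸩) (y : Fin n → MicroInfty) :
    combGauge A G y = combFrame A (y ᵥ* Gᵀ.map ofLaurentW) := rfl

theorem map_transpose_mul_cancel {G H : Matrix (Fin n) (Fin n) ℂ⸨X⸩} (h : H * G = 1) :
    Gᵀ.map ofLaurentW * Hᵀ.map ofLaurentW = 1 := by
  rw [← Matrix.map_mul, ← transpose_mul, h, transpose_one, Matrix.map_one _ (map_zero _) (map_one _)]

theorem combGauge_surjective {G H : Matrix (Fin n) (Fin n) ℂ⸨X⸩} (h : G * H = 1) :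
    Function.Surjective (combGauge A G) := by
  intro m
  obtain ⟨x, rfl⟩ := combFrame_surjective A m
  refine ⟨x ᵥ* Hᵀ.map ofLaurentW, ?_⟩
  rw [combGauge_apply, vecMul_vecMul, map_transpose_mul_cancel h, vecMul_one]

/-- The gauge identity intertwines the relations of `A` and of `B`, and `G` is invertible over
`ℂ((w))`. So the formal frame presents the same module although it is not defined over `ℂ[z]`. -/
theorem combGauge_eq_zero_iff {G H : Matrix (Fin n) (Fin n) ℂ⸨X⸩} (h : H * G = 1) (h' : G * H = 1)
    (hG : G.map derivZ + A.map expandInfty * G = G * B) {y : Fin n → MicroInfty} :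
    combGauge A G y = 0 ↔ ∃ x, x ᵥ* relMatrix B = y := by
  have hrel := gauge_mul_relMatrix hG
  have h1 := map_transpose_mul_cancel h
  have h2 := map_transpose_mul_cancel h'
  constructor
  · intro h0
    obtain ⟨u, hu⟩ := combFrame_eq_zero A h0
    rw [vecMulLinear_apply] at hu
    refine ⟨u ᵥ* Hᵀ.map ofLaurentW, ?_⟩
    have h3 : (u ᵥ* Hᵀ.map ofLaurentW) ᵥ* relMatrix B ᵥ* Gᵀ.map ofLaurentW =
        y ᵥ* Gᵀ.map ofLaurentW := by
      rw [← hu, vecMul_vecMul, ← hrel, vecMul_vecMul, ← Matrix.mul_assoc, h2, Matrix.one_mul]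
    have h4 := congrArg (· ᵥ* Hᵀ.map ofLaurentW) h3
    simpa only [vecMul_vecMul, Matrix.mul_assoc, h1, Matrix.mul_one, vecMul_one] using h4
  · rintro ⟨x, rfl⟩
    rw [combGauge_apply, vecMul_vecMul, ← hrel, ← vecMul_vecMul, combFrame_vecMul_relMatrix]

variable {D : ℤ} {ω : Fin n → ℤ → ℤ} {up : Fin n → ℤ → Prop}
  {p : Fin n → Fin n} {a : Fin n → ℤ} {root : Fin n → Prop}

open Classical in
theorem sum_smul_combGauge (G : Matrix (Fin n) (Fin n) ℂ⸨X⸩) (f : {k // root k} → ℂ⸨X⸩) :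
    ∑ r, f r • combGauge A G (Pi.single r.1 1) =
      combGauge A G (fun q => if hq : root q then ofLaurent (f ⟨q, hq⟩) else 0) := by
  have h : ∀ r, f r • combGauge A G (Pi.single r.1 1) =
      combGauge A G (Pi.single r.1 (ofLaurent (f r))) := by
    intro r
    change ofLaurent (f r) • combGauge A G (Pi.single r.1 1) = _
    rw [← map_smul, ← Pi.single_smul, smul_eq_mul, mul_one]
  rw [Finset.sum_congr rfl fun r _ => h r, ← map_sum]
  congr 1
  ext1 q
  rw [Finset.sum_apply]
  split_ifs with hq
  · rw [Finset.sum_eq_single ⟨q, hq⟩]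
    · simp
    · intro r _ hr
      rw [Pi.single_eq_of_ne]
      exact fun e => hr (Subtype.ext e.symm)
    · simp
  · refine Finset.sum_eq_zero fun r _ => ?_
    rw [Pi.single_eq_of_ne]
    rintro rfl
    exact hq r.2

/-- The formal frame vectors at the roots form a basis: `exists_division` shows that they span,
`division_unique` that they are independent. -/
theorem rk_eq_card_root (G : Matrix.GeneralLinearGroup (Fin n) ℂ⸨X⸩)
    (hG : G.val.map derivZ + A.map expandInfty * G.val = G.val * B)
    (h : LeadingChoice B D ω up p a root) :
    rk (ConnectionModule A) = Nat.card {k // root k} := by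
  classical
  have hinv : G⁻¹.val * G.val = 1 := G.inv_mul
  have hinv' : G.val * G⁻¹.val = 1 := G.mul_inv
  let v : {k // root k} → MicrolocalizationInfty (ConnectionModule A) :=
    fun r => combGauge A G.val (Pi.single r.1 1)
  have hli : LinearIndependent ℂ⸨X⸩ v := by
    rw [Fintype.linearIndependent_iff]
    intro f hf r
    rw [sum_smul_combGauge, combGauge_eq_zero_iff hinv hinv' hG] at hf
    obtain ⟨x, hx⟩ := hf
    set c : Fin n → MicroInfty := fun q => if hq : root q then ofLaurent (f ⟨q, hq⟩) else 0 with hc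
    -- The uniqueness statement wants a vanishing sum, so the relation `c = x (∂ - Bᵀ)` enters with
    -- `-x`.
    have h1 := vecMul_relMatrix_ofSymbol B (fun k => ofSymbol.symm (-x k))
    have h2 : (fun q => ofSymbol.symm (c q)) +
        relComb B (fun k => ofSymbol.symm (-x k)) = 0 := by
      ext1 q
      refine ofSymbol.injective ?_
      rw [Pi.add_apply, map_add, ← congrFun h1 q]
      simp only [LinearEquiv.apply_symm_apply]
      rw [show (fun k => -x k) = -x from rfl, neg_vecMul, hx]
      simp
    have h3 := h.division_unique (fun q s hs => ?_) h2
    · have h4 := congrArg ofSymbol (congrFun h3 r.1)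
      simp only [hc, LinearEquiv.apply_symm_apply, dif_pos r.2] at h4
      exact ofLaurent_injective (h4.trans (by simp))
    · by_cases hq : root q
      · simp only [hc, dif_pos hq] at hs
        exact ⟨coeff_ofLaurent_ne hs, hq⟩
      · simp [hc, hq] at hs
  have hsp : ⊤ ≤ Submodule.span ℂ⸨X⸩ (Set.range v) := by
    rintro m -
    obtain ⟨y, rfl⟩ := combGauge_surjective (A := A) hinv' m
    obtain ⟨C, x, hC, hy⟩ := h.exists_division (fun k => ofSymbol.symm (y k))
    choose f hf using fun q => exists_ofLaurent_eq fun s hs => (hC q s hs).1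
    have h1 : y = (fun q => if hq : root q then ofLaurent (f q) else 0) +
        (fun k => ofSymbol (x k)) ᵥ* relMatrix B := by
      rw [vecMul_relMatrix_ofSymbol]
      ext1 q
      have h2 := congrArg ofSymbol (congrFun hy q)
      rw [LinearEquiv.apply_symm_apply, Pi.add_apply, map_add] at h2
      rw [Pi.add_apply, h2]
      congr 1
      split_ifs with hq
      · exact (hf q).symm
      · have : C q = 0 := by
          ext s
          by_contra hs
          exact hq (hC q s hs).2
        rw [this, map_zero]
    rw [h1, map_add, (combGauge_eq_zero_iff hinv hinv' hG).2 ⟨_, rfl⟩, add_zero,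
      ← sum_smul_combGauge G.val (fun r => f r.1)]
    exact Submodule.sum_mem _ fun r _ => Submodule.smul_mem _ _ (Submodule.subset_span ⟨r, rfl⟩)
  rw [rk, rank_eq_card_basis (Module.Basis.mk hli hsp), Nat.card_eq_fintype_card]

end MicrolocalizationInfty

/-! ### Formal local forms at infinity -/

theorem smul_add_smul_mul_eq {ι R : Type*} [Fintype ι] [CommRing R] {X Y G Z : Matrix ι ι R} (s : R)
    (h : X + Y * G = G * Z) : s • X + s • Y * G = G * s • Z := by
  rw [Matrix.smul_mul, ← smul_add, h, Matrix.mul_smul]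

/-- Passing from `dw` to `dz` multiplies by `dw/dz = -w²`. The poles of order `3, 2, 1` move to
exponents `-1, 0, 1` with a sign, and the unknown part `O(1)` starts at exponent `2`. -/
theorem HasLocalFormInfty.exists_gauge {n : ℕ} {A : Matrix (Fin n) (Fin n) ℂ[X]}
    {L₃ L₂ L₁ : Matrix (Fin n) (Fin n) ℂ} (h : HasLocalFormInfty A L₃ L₂ L₁) :
    ∃ (G : Matrix.GeneralLinearGroup (Fin n) ℂ⸨X⸩) (B : Matrix (Fin n) (Fin n) ℂ⸨X⸩),
      G.val.map derivZ + A.map expandInfty * G.val = G.val * B ∧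
      ∀ q k c, c < 2 → (B q k).coeff c =
        -((if c = -1 then L₃ q k else 0) + (if c = 0 then L₂ q k else 0) +
          (if c = 1 then L₁ q k else 0)) := by
  obtain ⟨G, H, h⟩ := h
  set Λ := L₃.map (HahnSeries.single (-3 : ℤ)) + L₂.map (HahnSeries.single (-2 : ℤ)) +
    L₁.map (HahnSeries.single (-1 : ℤ)) + H.map (HahnSeries.ofPowerSeries ℤ ℂ) with hΛ
  let s : ℂ⸨X⸩ := HahnSeries.single (2 : ℤ) (-1 : ℂ)
  have hneg : (HahnSeries.single (-2 : ℤ) (-1 : ℂ) : ℂ⸨X⸩) = -HahnSeries.single (-2 : ℤ) (1 : ℂ) :=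
    HahnSeries.single_neg _ _
  have hs : s * HahnSeries.single (-2 : ℤ) (-1 : ℂ) = 1 := by
    rw [HahnSeries.single_mul_single]
    simp
  refine ⟨G, s • Λ, ?_, fun q k c hc => ?_⟩
  · have h1 : G.val.map derivZ = s • G.val.map (LaurentSeries.derivative ℂ) := rfl
    have h2 : A.map expandInfty = s • connectionMatrixInfty A := by
      ext1 i j
      have h3 : connectionMatrixInfty A i j =
          (HahnSeries.single (-2 : ℤ) (-1 : ℂ) : ℂ⸨X⸩) * expandInfty (A i j) := by
        rw [hneg]
        rfl
      rw [Matrix.smul_apply, smul_eq_mul, h3, ← mul_assoc, hs, one_mul, map_apply]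
    rw [h1, h2]
    exact smul_add_smul_mul_eq s h
  · have h1 : ((s • Λ) q k).coeff c = -(Λ q k).coeff (c - 2) := by
      rw [Matrix.smul_apply, smul_eq_mul, HahnSeries.coeff_single_mul, neg_one_mul]
    have h2 : (HahnSeries.ofPowerSeries ℤ ℂ (H q k)).coeff (c - 2) = 0 := by
      rw [HahnSeries.ofPowerSeries_apply]
      refine HahnSeries.embDomain_of_notMem_range ?_
      rintro ⟨m, hm⟩
      have : (m : ℤ) = c - 2 := hm
      omega
    have e3 : c - 2 = -3 ↔ c = -1 := by omega
    have e2 : c - 2 = -2 ↔ c = 0 := by omega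
    have e1 : c - 2 = -1 ↔ c = 1 := by omega
    rw [h1, hΛ]
    simp only [Matrix.add_apply, map_apply, HahnSeries.coeff_add, HahnSeries.coeff_single, h2,
      add_zero, e3, e2, e1]

theorem exists_entry_ne_zero {B : ℂ⸨X⸩} {l₃ l₂ l₁ : ℂ}
    (hB : ∀ c < 2, B.coeff c =
      -((if c = -1 then l₃ else 0) + (if c = 0 then l₂ else 0) + (if c = 1 then l₁ else 0)))
    {c : ℤ} (hc : B.coeff c ≠ 0) :
    (c = -1 ∧ l₃ ≠ 0) ∨ (c = 0 ∧ l₂ ≠ 0) ∨ (c = 1 ∧ l₁ ≠ 0) ∨ 2 ≤ c := by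
  by_cases h2 : 2 ≤ c
  · exact .inr (.inr (.inr h2))
  rw [hB c (by omega)] at hc
  by_cases h3 : c = -1
  · subst h3; simp at hc; simp [hc]
  by_cases h4 : c = 0
  · subst h4; simp at hc; simp [hc]
  by_cases h5 : c = 1
  · subst h5; simp at hc; simp [hc]
  simp [h3, h4, h5] at hc

/-! ### Weights and leading terms in the three cases -/

namespace MicroSymbol

/-- A concave weight of the exponent `6 j + s k` of `w^j e_k`. -/
def kinkWeight {n : ℕ} (s : Fin n → ℤ) (k : Fin n) (j : ℤ) : ℤ :=
  min (6 * j + s k) (3 * (6 * j + s k))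

theorem kinkWeight_mono {n : ℕ} (s : Fin n → ℤ) (k : Fin n) : Monotone (kinkWeight s k) := by
  intro i j h
  simp only [kinkWeight]
  omega

variable {B : Matrix (Fin 3) (Fin 3) ℂ⸨X⸩}

set_option maxHeartbeats 1000000 in
-- The components with `t₁, t₂` have a term `w⁻¹`, which costs `6` for `j ≥ 1` and `18` for `j ≤ 0`,
-- against `7` for `∂`; `w^0 e_1` and `w^0 e_2` are then led by no relation. Component `0` has no
-- such term, so `∂` always leads there and the value `1` of `a` is a dummy.
theorem leadingChoice_of_regular_semisimple {t₁ t₂ b₁ b₂ c₀ c₁ c₂ : ℂ} (ht₁ : t₁ ≠ 0)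
    (ht₂ : t₂ ≠ 0)
    (hB : ∀ q k c, c < 2 → (B q k).coeff c =
        -((if c = -1 then !![0, 0, 0; 0, t₁, 0; 0, 0, t₂] q k else 0) +
          (if c = 0 then !![0, 0, 0; 0, b₁, 0; 0, 0, b₂] q k else 0) +
          (if c = 1 then !![c₀, 0, 0; 0, c₁, 0; 0, 0, c₂] q k else 0))) :
    LeadingChoice B 7 (kinkWeight ![0, 0, 0]) (fun k j => k = 0 ∨ 1 ≤ j) id ![1, -1, -1]
      (fun k => k ≠ 0) := by
  -- Lower bounds for the exponents in each entry; the value `2` marks entries to which only `O(1)`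
  -- contributes.
  have hc : ∀ q k c, (B q k).coeff c ≠ 0 → !![1, 2, 2; 2, -1, 2; 2, 2, -1] q k ≤ c := by
    intro q k c h
    have := exists_entry_ne_zero (hB q k) h
    fin_cases q <;> fin_cases k <;> simp at this ⊢ <;> omega
  refine ⟨by norm_num, kinkWeight_mono _, Function.bijective_id, ?_, ?_, ?_, ?_, ?_⟩
  · intro k j
    fin_cases k <;> simp <;> omega
  · intro k j h
    rw [hB _ _ _ (by fin_cases k <;> simp)]
    fin_cases k <;> simp_all
  · intro k q j i c l hu h
    have := hc q k c h
    fin_cases k <;> fin_cases q <;> simp [Raises, InRegion, weight, kinkWeight] at hu this ⊢ <;>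
      (constructor <;> intros <;> omega)
  -- The term with `∂` lowers the exponent of `ŵ`. The region survives because `ω` is negative at
  -- the source, so its bound on the weight keeps `i` away from `-m`.
  · intro k j i hu
    fin_cases k <;> simp [Raises, InRegion, weight, kinkWeight] at hu ⊢ <;>
      (constructor <;> intros <;> omega)
  · intro k q j i c l hu h hne
    have := hc q k c h
    fin_cases k <;> fin_cases q <;>
      simp [Raises, InRegion, weight, kinkWeight] at hu this hne ⊢ <;>
      (constructor <;> intros <;> omega)

set_option maxHeartbeats 1000000 in
-- The leading entries `1` and `b` exchange components `0` and `1`, and a full cycle costs one power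
-- of `w`. The shift `3` divides its cost `6` evenly, giving `3` per step (`9` below the threshold);
-- this is the eigenvalue growth `z^(1/2)`. The thresholds are `0` for the relation of `e_0` and `1`
-- for that of `e_1`, which leaves `w^0 e_1` uncovered. Component `2` behaves as in the semisimple
-- case and leaves `w^0 e_2`.
theorem leadingChoice_of_nilpotent_block {t b c₀ c₁ c₂ : ℂ} (ht : t ≠ 0) (hb : b ≠ 0)
    (hB : ∀ q k c, c < 2 → (B q k).coeff c =
        -((if c = -1 then !![0, 1, 0; 0, 0, 0; 0, 0, t] q k else 0) +
          (if c = 0 then !![0, 0, 0; b, 0, 0; 0, 0, 0] q k else 0) +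
          (if c = 1 then !![0, 0, 0; c₀, c₁, 0; 0, 0, c₂] q k else 0))) :
    LeadingChoice B 7 (kinkWeight ![3, 0, 0]) (fun k j => ![0, 1, 1] k ≤ j) ![1, 0, 2]
      ![0, -1, -1] (fun k => k ≠ 0) := by
  have hc : ∀ q k c, (B q k).coeff c ≠ 0 → !![2, -1, 2; 0, 1, 2; 2, 2, -1] q k ≤ c := by
    intro q k c h
    have := exists_entry_ne_zero (hB q k) h
    fin_cases q <;> fin_cases k <;> simp at this ⊢ <;> omega
  refine ⟨by norm_num, kinkWeight_mono _, by decide, ?_, ?_, ?_, ?_, ?_⟩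
  · intro k j
    fin_cases k <;> simp <;> omega
  · intro k j h
    rw [hB _ _ _ (by fin_cases k <;> simp)]
    fin_cases k <;> simp_all
  · intro k q j i c l hu h
    have := hc q k c h
    fin_cases k <;> fin_cases q <;> simp [Raises, InRegion, weight, kinkWeight] at hu this ⊢ <;>
      (constructor <;> intros <;> omega)
  · intro k j i hu
    fin_cases k <;> simp [Raises, InRegion, weight, kinkWeight] at hu ⊢ <;>
      (constructor <;> intros <;> omega)
  · intro k q j i c l hu h hne
    have := hc q k c h
    fin_cases k <;> fin_cases q <;>
      simp [Raises, InRegion, weight, kinkWeight] at hu this hne ⊢ <;>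
      (constructor <;> intros <;> omega)

set_option maxHeartbeats 1000000 in
-- The leading entries form one cycle `0 → 2 → 1 → 0` costing two powers of `w`. The shifts `2, 0,
-- -2` divide its cost `12` into three steps of `4`, the growth `z^(2/3)`. Below the threshold a
-- step costs `12`, except that the step from `e_0` to `e_2` at `j = 0` crosses the kink and costs
-- `8`. Together with the cost `6` in the other cases this singles out `7` as the integer weight of
-- `ŵ`. The step into `e_2` has `a = 0` and leaves no gap there, so the roots are `0` and `1`.
theorem leadingChoice_of_regular_nilpotent {b c₀ c₁ c₂ : ℂ} (hb : b ≠ 0)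
    (hB : ∀ q k c, c < 2 → (B q k).coeff c =
        -((if c = -1 then !![0, 1, 0; 0, 0, 1; 0, 0, 0] q k else 0) +
          (if c = 0 then !![0, 0, 0; 0, 0, 0; b, 0, 0] q k else 0) +
          (if c = 1 then !![0, 0, 0; 0, 0, 0; c₀, c₁, c₂] q k else 0))) :
    LeadingChoice B 7 (kinkWeight ![2, 0, -2]) (fun _ j => 1 ≤ j) ![2, 0, 1]
      ![0, -1, -1] (fun k => k ≠ 2) := by
  have hc : ∀ q k c, (B q k).coeff c ≠ 0 → !![2, -1, 2; 2, 2, -1; 0, 1, 1] q k ≤ c := by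
    intro q k c h
    have := exists_entry_ne_zero (hB q k) h
    fin_cases q <;> fin_cases k <;> simp at this ⊢ <;> omega
  refine ⟨by norm_num, kinkWeight_mono _, by decide, ?_, ?_, ?_, ?_, ?_⟩
  · intro k j
    fin_cases k <;> simp <;> omega
  · intro k j h
    rw [hB _ _ _ (by fin_cases k <;> simp)]
    fin_cases k <;> simp_all
  · intro k q j i c l hu h
    have := hc q k c h
    fin_cases k <;> fin_cases q <;> simp [Raises, InRegion, weight, kinkWeight] at hu this ⊢ <;>
      (constructor <;> intros <;> omega)
  · intro k j i hu
    fin_cases k <;> simp [Raises, InRegion, weight, kinkWeight] at hu ⊢ <;>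
      (constructor <;> intros <;> omega)
  · intro k q j i c l hu h hne
    have := hc q k c h
    fin_cases k <;> fin_cases q <;>
      simp [Raises, InRegion, weight, kinkWeight] at hu this hne ⊢ <;>
      (constructor <;> intros <;> omega)

end MicroSymbol

theorem mainTheorem4 (A : Matrix (Fin 3) (Fin 3) (Polynomial ℂ)) :
    (∀ t₁ t₂ b₁ b₂ c₀ c₁ c₂ : ℂ, t₁ ≠ 0 → t₂ ≠ 0 → t₁ ≠ t₂ →
      HasLocalFormInfty A
        !![0, 0, 0; 0, t₁, 0; 0, 0, t₂]
        !![0, 0, 0; 0, b₁, 0; 0, 0, b₂]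
        !![c₀, 0, 0; 0, c₁, 0; 0, 0, c₂] →
      MicrolocalizationInfty.rk (ConnectionModule A) = 2) ∧
    (∀ t b c₀ c₁ c₂ : ℂ, t ≠ 0 → b ≠ 0 →
      HasLocalFormInfty A
        !![0, 1, 0; 0, 0, 0; 0, 0, t]
        !![0, 0, 0; b, 0, 0; 0, 0, 0]
        !![0, 0, 0; c₀, c₁, 0; 0, 0, c₂] →
      MicrolocalizationInfty.rk (ConnectionModule A) = 2) ∧
    (∀ b c₀ c₁ c₂ : ℂ, b ≠ 0 →
      HasLocalFormInfty A
        !![0, 1, 0; 0, 0, 1; 0, 0, 0]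
        !![0, 0, 0; 0, 0, 0; b, 0, 0]
        !![0, 0, 0; 0, 0, 0; c₀, c₁, c₂] →
      MicrolocalizationInfty.rk (ConnectionModule A) = 2) := by
  have hcard : ∀ i : Fin 3, (Nat.card {k : Fin 3 // k ≠ i} : Cardinal) = 2 := by
    intro i
    simp
  refine ⟨?_, ?_, ?_⟩
  · intro t₁ t₂ b₁ b₂ c₀ c₁ c₂ ht₁ ht₂ _ h
    obtain ⟨G, B, hG, hB⟩ := h.exists_gauge
    rw [MicrolocalizationInfty.rk_eq_card_root G hG
      (MicroSymbol.leadingChoice_of_regular_semisimple ht₁ ht₂ hB), hcard]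
  · intro t b c₀ c₁ c₂ ht hb h
    obtain ⟨G, B, hG, hB⟩ := h.exists_gauge
    rw [MicrolocalizationInfty.rk_eq_card_root G hG
      (MicroSymbol.leadingChoice_of_nilpotent_block ht hb hB), hcard]
  · intro b c₀ c₁ c₂ hb h
    obtain ⟨G, B, hG, hB⟩ := h.exists_gauge
    rw [MicrolocalizationInfty.rk_eq_card_root G hG
      (MicroSymbol.leadingChoice_of_regular_nilpotent hb hB), hcard]
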